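/- Let $d\ge 1$ and let functions on $\mathbb{R}^d$ be real- or complex-valued. Write $\mathcal{D}_hf(x)=f(x+h)-f(x)$, let $\mathcal{D}_h^k$ be its $k$-th iterate, and let $[\gamma]^-$ be the smallest integer strictly larger than $\gamma$. For $\gamma>0$, $p\in(1,\infty]$ and measurable, locally integrable $f$ put $$\|f\|_{\dot\Lambda^\gamma_p}=\left(\int_{\mathbb{R}^d}\frac{\|\mathcal{D}_h^{[\gamma]^-}f\|_{L_\infty(\mathbb{R}^d)}^p}{|h|^{d+p\gamma}}\,dh\right)^{1/p}\ (p<\infty),\qquad \|f\|_{\dot\Lambda^\gamma_\infty}=\sup_{h\neq 0}\frac{\|\mathcal{D}_h^{[\gamma]^-}f\|_{L_\infty(\mathbb{R}^d)}}{|h|^{\gamma}},$$ and $\|f\|_{\Lambda^\gamma_p}=\|f\|_{L_\infty}+\|f\|_{\dot\Lambda^\gamma_p}$; all these quantities take values in $[0,\infty]$. Let $\gamma=n+\delta$ with $n\in\mathbb{N}\cup\{0\}$ and $\delta\in(0,1]$, and let $p\in(1,\infty]$. Then there is a constant $N\in(0,\infty)$, depending only on $d,\gamma,p$, such that the following holds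 for every $f\in L_\infty(\mathbb{R}^d)$. 1. If $\|f\|_{\Lambda^\gamma_p}<\infty$, then for every multi-index $\alpha$ with $|\alpha|\le n$ the weak derivative $D^\alpha f$ exists and belongs to $L_\infty(\mathbb{R}^d)$. 2. Whenever the weak derivatives $D^\alpha f$, $|\alpha|\le n$, exist as locally integrable functions, $$N^{-1}\,\|f\|_{\Lambda^\gamma_p}\le \sum_{|\alpha|\le n}\|D^\alpha f\|_{L_\infty}+\sum_{|\beta|=n}\|D^\beta f\|_{\dot\Lambda^\delta_p}\le N\,\|f\|_{\Lambda^\gamma_p}$$ as an inequality in $[0,\infty]$. -/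

import Mathlib

open MeasureTheory
open scoped ENNReal

namespace HolderZygmund

/-- Euclidean space `ℝ^d`. -/
abbrev Rd (d : ℕ) : Type := EuclideanSpace ℝ (Fin d)

/-- `[γ]⁻`, the smallest integer strictly larger than `γ` (for `γ ≥ 0`). -/
noncomputable def diffOrder (γ : ℝ) : ℕ := ⌊γ⌋₊ + 1

theorem diffOrder_isLeast (γ : ℝ) (hγ : 0 ≤ γ) :
    IsLeast {m : ℤ | γ < (m : ℝ)} (diffOrder γ : ℤ) := by
  constructor
  · have h := Nat.lt_floor_add_one γ
    simpa [diffOrder] using h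
  · intro m hm
    have hm' : γ < (m : ℝ) := hm
    have h0 : (⌊γ⌋₊ : ℝ) ≤ γ := Nat.floor_le hγ
    have h1 : ((⌊γ⌋₊ : ℤ) : ℝ) < (m : ℝ) := by
      rw [Int.cast_natCast]
      exact lt_of_le_of_lt h0 hm'
    have h2 : (⌊γ⌋₊ : ℤ) < m := by exact_mod_cast h1
    simp only [diffOrder, Nat.cast_add, Nat.cast_one]
    omega

/-- The `L_∞(ℝ^d)` norm of the iterated difference `𝒟_h^k f`, where `k = [γ]⁻` and
`𝒟_h f (x) = f (x + h) - f x`. -/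
noncomputable def diffNorm {d : ℕ} {𝕜 : Type*} [RCLike 𝕜] (γ : ℝ) (f : Rd d → 𝕜)
    (h : Rd d) : ℝ≥0∞ :=
  eLpNorm ((fwdDiff h)^[diffOrder γ] f) ∞ volume

open Classical in
/-- The homogeneous seminorm of `f`, with values in `[0, ∞]`. For `h = 0` the numerator vanishes
and `0 / 0 = 0` in `[0, ∞]`, so this value of `h` contributes nothing to the supremum. -/
noncomputable def zygmundSeminorm {d : ℕ} {𝕜 : Type*} [RCLike 𝕜] (γ : ℝ) (p : ℝ≥0∞)
    (f : Rd d → 𝕜) : ℝ≥0∞ :=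
  if p = ∞ then ⨆ h : Rd d, diffNorm γ f h / ‖h‖ₑ ^ γ
  else (∫⁻ h : Rd d, diffNorm γ f h ^ p.toReal / ‖h‖ₑ ^ ((d : ℝ) + p.toReal * γ)) ^ (1 / p.toReal)

/-- The full norm, with values in `[0, ∞]`; `f ∈ L_∞` belongs to the Hölder-Zygmund space
exactly when it is finite. -/
noncomputable def zygmundNorm {d : ℕ} {𝕜 : Type*} [RCLike 𝕜] (γ : ℝ) (p : ℝ≥0∞)
    (f : Rd d → 𝕜) : ℝ≥0∞ :=
  eLpNorm f ∞ volume + zygmundSeminorm γ p f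

/-- The length `|α|` of a multi-index. -/
def multiLength {d : ℕ} (α : Fin d → ℕ) : ℕ := ∑ i, α i

/-- The classical partial derivative `∂_i φ`. -/
noncomputable def partialDeriv {d : ℕ} (i : Fin d) (φ : Rd d → ℝ) : Rd d → ℝ :=
  fun x => fderiv ℝ φ x (EuclideanSpace.single i 1)

/-- The classical derivative `D^α φ = ∂_1^{α_1} ⋯ ∂_d^{α_d} φ`. -/
noncomputable def multiDeriv {d : ℕ} (α : Fin d → ℕ) (φ : Rd d → ℝ) : Rd d → ℝ :=
  (List.finRange d).foldr (fun i ψ => (partialDeriv i)^[α i] ψ) φ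

/-- `g` is a weak (distributional) derivative `D^α f`. -/
def HasWeakDeriv {d : ℕ} {𝕜 : Type*} [RCLike 𝕜] (α : Fin d → ℕ) (f g : Rd d → 𝕜) : Prop :=
  LocallyIntegrable f volume ∧ LocallyIntegrable g volume ∧
    ∀ φ : Rd d → ℝ, ContDiff ℝ ((⊤ : ℕ∞) : WithTop ℕ∞) φ → HasCompactSupport φ →
      ∫ x, multiDeriv α φ x • f x = (-1 : ℝ) ^ multiLength α • ∫ x, φ x • g x

/-- `∑_{|α| ≤ n} ‖D^α f‖_∞ + ∑_{|β| = n} [D^β f]`, where `[·]` is the homogeneous seminorm of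
order `δ` and the functions `Df α` are the derivatives `D^α f`. -/
noncomputable def derivNorm {d : ℕ} {𝕜 : Type*} [RCLike 𝕜] (n : ℕ) (δ : ℝ) (p : ℝ≥0∞)
    (Df : (Fin d → ℕ) → Rd d → 𝕜) : ℝ≥0∞ :=
  (∑ k ∈ Finset.range (n + 1), ∑ α ∈ Finset.piAntidiag (Finset.univ : Finset (Fin d)) k,
      eLpNorm (Df α) ∞ volume) +
    ∑ β ∈ Finset.piAntidiag (Finset.univ : Finset (Fin d)) n, zygmundSeminorm δ p (Df β)

end HolderZygmund

/-! Derivatives from differences. Put m = [γ]⁻ and let T_j be the operator `corr` with kernel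
`diffKernel` at scale 2^{-j}. The kernel is a binomial combination of dilated bumps, so that f - T_j
f is, up to sign, a weighted average of the m-th differences of f with steps |h| < 2^{-j}
(`sub_corr_diffKernel`). The approximations used are T_j² f, because T_{j+1}² - T_j² = (T_{j+1} +
T_j)(T_{j+1} - T_j): the steps e_j = T_{j+1} f - T_j f are small in sup norm, and the outer factor
is still a smooth kernel, so that D^α costs only 2^{j|α|}.

Let b_j be 2^{jγ} times the average of the sup norms of the m-th differences over |h| < 2^{-j}. A
Hardy-type inequality bounds the ℓ_p norm of b by the seminorm of f (`exists_seqNorm_dyadicAvg_le`).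
As 2^{jn} = 2^{-jδ} 2^{jγ}, the telescoping series may be differentiated up to order n with uniform
convergence, and its sum is a bounded weak derivative (`exists_hasWeakDeriv_of_tsum_ballAvg`). With
k = [δ]⁻, the k-th difference of its j-th term is at most a constant times min(1, (2^j |h|)^k)
2^{-jδ} b_j. Since 0 < δ < k, a second Hardy-type inequality returns the seminorm of order δ
(`exists_zygmundSeminorm_le_seqNorm`). For δ = 1 this needs k = 2, which is what [δ]⁻ gives.

Differences from derivatives. Here [γ]⁻ = [δ]⁻ + n. Mollification shows that a function with bounded
weak gradient is Lipschitz (`eLpNorm_fwdDiff_le`), so n of the differences can be traded for n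
derivatives and a factor |h|^n, which is exactly the change of weight between the seminorms of
orders γ and δ (`zygmundSeminorm_le_sum`). Uniqueness of weak derivatives transfers the first bound
to any prescribed family of derivatives. -/

namespace HolderZygmund

/-! ### Test functions and commuting partial derivatives -/

variable {d : ℕ} {𝕜 : Type*} [RCLike 𝕜]

/-- Smooth compactly supported real functions. -/
structure IsTest (φ : Rd d → ℝ) : Prop where
  smooth : ContDiff ℝ ((⊤ : ℕ∞) : WithTop ℕ∞) φ
  compact : HasCompactSupport φ

theorem IsTest.continuous {φ : Rd d → ℝ} (h : IsTest φ) : Continuous φ := h.smooth.continuous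

theorem IsTest.differentiable {φ : Rd d → ℝ} (h : IsTest φ) : Differentiable ℝ φ :=
  h.smooth.differentiable (by simp)

theorem IsTest.integrable {φ : Rd d → ℝ} (h : IsTest φ) : Integrable φ :=
  h.continuous.integrable_of_hasCompactSupport h.compact

theorem IsTest.add {φ ψ : Rd d → ℝ} (h : IsTest φ) (h' : IsTest ψ) :
    IsTest (fun x => φ x + ψ x) :=
  ⟨h.smooth.add h'.smooth, h.compact.add h'.compact⟩

theorem IsTest.const_mul {φ : Rd d → ℝ} (h : IsTest φ) (c : ℝ) : IsTest (fun x => c * φ x) :=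
  ⟨contDiff_const.mul h.smooth, h.compact.mul_left⟩

theorem IsTest.zero : IsTest (fun _ : Rd d => (0 : ℝ)) :=
  ⟨contDiff_const, HasCompactSupport.zero⟩

theorem IsTest.sum {ι : Type*} (s : Finset ι) {φ : ι → Rd d → ℝ} (h : ∀ i ∈ s, IsTest (φ i)) :
    IsTest (fun x => ∑ i ∈ s, φ i x) := by
  classical
  induction s using Finset.induction_on with
  | empty => simpa using IsTest.zero
  | insert a s ha ih =>
    simp only [Finset.sum_insert ha]
    exact (h a (by simp)).add (ih fun i hi => h i (by simp [hi]))

theorem IsTest.comp_affine {φ : Rd d → ℝ} (h : IsTest φ) {c : ℝ} (hc : c ≠ 0) (z : Rd d) :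
    IsTest (fun x => φ (z + c • x)) := by
  refine ⟨h.smooth.comp (contDiff_const.add (contDiff_id.const_smul c)), ?_⟩
  have := h.compact.comp_homeomorph ((Homeomorph.smulOfNeZero c hc).trans (Homeomorph.addLeft z))
  exact this

theorem IsTest.partialDeriv {φ : Rd d → ℝ} (h : IsTest φ) (i : Fin d) :
    IsTest (partialDeriv i φ) := by
  refine ⟨?_, ?_⟩
  · exact (h.smooth.fderiv_right (m := ((⊤ : ℕ∞) : WithTop ℕ∞)) (by simp)).clm_apply contDiff_const
  · exact h.compact.fderiv_apply (𝕜 := ℝ) _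

theorem IsTest.iterate_partialDeriv {φ : Rd d → ℝ} (h : IsTest φ) (i : Fin d) (k : ℕ) :
    IsTest ((HolderZygmund.partialDeriv i)^[k] φ) := by
  induction k with
  | zero => exact h
  | succ k ih => rw [Function.iterate_succ_apply']; exact ih.partialDeriv i

theorem IsTest.foldr {φ : Rd d → ℝ} (h : IsTest φ) (α : Fin d → ℕ) (l : List (Fin d)) :
    IsTest (l.foldr (fun i ψ => (HolderZygmund.partialDeriv i)^[α i] ψ) φ) := by
  induction l with
  | nil => exact h
  | cons a l ih => exact ih.iterate_partialDeriv a _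

theorem IsTest.multiDeriv {φ : Rd d → ℝ} (h : IsTest φ) (α : Fin d → ℕ) :
    IsTest (multiDeriv α φ) := h.foldr α _

theorem partialDeriv_comm {φ : Rd d → ℝ} (h : IsTest φ) (i j : Fin d) :
    partialDeriv i (partialDeriv j φ) = partialDeriv j (partialDeriv i φ) := by
  funext x
  have hd : Differentiable ℝ (fderiv ℝ φ) :=
    (h.smooth.fderiv_right (m := ((⊤ : ℕ∞) : WithTop ℕ∞)) (by simp)).differentiable (by simp)
  have key : ∀ a b : Fin d, partialDeriv a (partialDeriv b φ) x
      = fderiv ℝ (fderiv ℝ φ) x (EuclideanSpace.single a 1) (EuclideanSpace.single b 1) := by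
    intro a b
    have := (hd x).hasFDerivAt.clm_apply (hasFDerivAt_const (EuclideanSpace.single b (1 : ℝ)) x)
    change fderiv ℝ (fun y => fderiv ℝ φ y (EuclideanSpace.single b 1)) x _ = _
    rw [this.fderiv]
    simp
  rw [key, key]
  exact (h.smooth.contDiffAt.isSymmSndFDerivAt
    (by simpa using WithTop.coe_le_coe.2 (le_top : (2 : ℕ∞) ≤ ⊤))) _ _

theorem partialDeriv_iterate_comm {φ : Rd d → ℝ} (h : IsTest φ) (i j : Fin d) (k : ℕ) :
    partialDeriv i ((partialDeriv j)^[k] φ) = (partialDeriv j)^[k] (partialDeriv i φ) := by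
  induction k with
  | zero => rfl
  | succ k ih =>
    rw [Function.iterate_succ_apply', Function.iterate_succ_apply',
      partialDeriv_comm (h.iterate_partialDeriv j k), ih]

theorem partialDeriv_foldr {φ : Rd d → ℝ} (h : IsTest φ) (α : Fin d → ℕ) (i : Fin d)
    (l : List (Fin d)) :
    partialDeriv i (l.foldr (fun i ψ => (partialDeriv i)^[α i] ψ) φ)
      = l.foldr (fun i ψ => (partialDeriv i)^[α i] ψ) (partialDeriv i φ) := by
  induction l with
  | nil => rfl
  | cons a l ih =>
    simp only [List.foldr_cons]
    rw [partialDeriv_iterate_comm (h.foldr α l), ih]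

/-- The extra ∂_i appears at the position of i in the ordered product and is commuted to the
innermost place. Distinctness of the list entries ensures that it appears only once. -/
theorem foldr_add_single {φ : Rd d → ℝ} (h : IsTest φ) (α : Fin d → ℕ) (i : Fin d)
    (l : List (Fin d)) (hl : l.Nodup) :
    l.foldr (fun j ψ => (partialDeriv j)^[(α + Pi.single i 1 : Fin d → ℕ) j] ψ) φ
      = l.foldr (fun j ψ => (partialDeriv j)^[α j] ψ) (if i ∈ l then partialDeriv i φ else φ) := by
  induction l with
  | nil => rfl
  | cons a l ih =>
    rw [List.nodup_cons] at hl
    simp only [List.foldr_cons]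
    rw [ih hl.2]
    by_cases hia : i = a
    · subst hia
      simp only [hl.1, if_false, List.mem_cons, true_or, if_true, Pi.add_apply, Pi.single_eq_same]
      rw [Function.iterate_succ_apply, partialDeriv_foldr h]
    · have : a ≠ i := fun h => hia h.symm
      simp [hia, this]

theorem multiDeriv_zero (φ : Rd d → ℝ) : multiDeriv 0 φ = φ := by
  have : ∀ l : List (Fin d),
      l.foldr (fun i ψ => (partialDeriv i)^[(0 : Fin d → ℕ) i] ψ) φ = φ := by
    intro l
    induction l with
    | nil => rfl
    | cons a l ih => simp
  exact this _

theorem multiDeriv_add_single {φ : Rd d → ℝ} (h : IsTest φ) (α : Fin d → ℕ) (i : Fin d) :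
    multiDeriv (α + Pi.single i 1) φ = multiDeriv α (partialDeriv i φ) := by
  have := foldr_add_single h α i (List.finRange d) (List.nodup_finRange d)
  simpa [multiDeriv] using this

theorem partialDeriv_multiDeriv {φ : Rd d → ℝ} (h : IsTest φ) (α : Fin d → ℕ) (i : Fin d) :
    partialDeriv i (multiDeriv α φ) = multiDeriv (α + Pi.single i 1) φ := by
  rw [multiDeriv_add_single h]
  exact partialDeriv_foldr h α i _

theorem multiDeriv_single {φ : Rd d → ℝ} (h : IsTest φ) (i : Fin d) :
    multiDeriv (Pi.single i 1) φ = partialDeriv i φ := by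
  have := multiDeriv_add_single h 0 i
  rwa [zero_add, multiDeriv_zero] at this

@[simp] theorem multiLength_zero : multiLength (0 : Fin d → ℕ) = 0 := by simp [multiLength]

@[simp] theorem multiLength_add_single (α : Fin d → ℕ) (i : Fin d) :
    multiLength (α + Pi.single i 1) = multiLength α + 1 := by
  simp [multiLength, Finset.sum_add_distrib]

@[simp] theorem multiLength_single (i : Fin d) :
    multiLength (Pi.single i 1 : Fin d → ℕ) = 1 := by
  simp [multiLength]

theorem multiIndex_induction {P : (Fin d → ℕ) → Prop} (h0 : P 0)
    (h1 : ∀ α i, P α → P (α + Pi.single i 1)) (α : Fin d → ℕ) : P α := by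
  induction hl : multiLength α generalizing α with
  | zero =>
    have : α = 0 := by
      funext i
      have := Finset.sum_eq_zero_iff.1 hl i (Finset.mem_univ i)
      simpa using this
    rwa [this]
  | succ l ih =>
    obtain ⟨i, -, hi⟩ : ∃ i ∈ Finset.univ, α i ≠ 0 := by
      by_contra! h
      rw [multiLength, Finset.sum_eq_zero h] at hl
      omega
    have hα : α = (α - Pi.single i 1) + Pi.single i 1 := by
      funext j
      by_cases hj : j = i
      · subst hj
        simp; omega
      · simp [hj]
    rw [hα] at hl ⊢
    rw [multiLength_add_single] at hl
    exact h1 _ i (ih _ (by omega))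

theorem integral_mul_partialDeriv {φ ψ : Rd d → ℝ} (hφ : IsTest φ) (hψ : IsTest ψ) (i : Fin d) :
    ∫ x, φ x * partialDeriv i ψ x = - ∫ x, partialDeriv i φ x * ψ x := by
  have hint : ∀ {u v : Rd d → ℝ}, IsTest u → IsTest v → Integrable (fun x => u x * v x) :=
    fun hu hv => (hu.continuous.mul hv.continuous).integrable_of_hasCompactSupport
      hu.compact.mul_right
  exact integral_mul_fderiv_eq_neg_fderiv_mul_of_integrable (hint (hφ.partialDeriv i) hψ)
    (hint hφ (hψ.partialDeriv i)) (hint hφ hψ) (fun x _ => hφ.differentiable x)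
    (fun x _ => hψ.differentiable x)

theorem partialDeriv_comp_affine {φ : Rd d → ℝ} (hφ : IsTest φ) (i : Fin d) (z : Rd d) (c : ℝ)
    (x : Rd d) :
    partialDeriv i (fun y => φ (z + c • y)) x = c * partialDeriv i φ (z + c • x) := by
  have h1 : HasFDerivAt (fun y : Rd d => z + c • y) (c • ContinuousLinearMap.id ℝ (Rd d)) x :=
    ((hasFDerivAt_id x).const_smul c).const_add z
  have := (hφ.differentiable (z + c • x)).hasFDerivAt.comp x h1
  simp only [partialDeriv]
  have h2 : (fun y => φ (z + c • y)) = φ ∘ (fun y : Rd d => z + c • y) := rfl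
  rw [h2, this.fderiv]
  simp

/-! ### Weak derivatives -/

theorem IsTest.integrable_smul {φ : Rd d → ℝ} (hφ : IsTest φ) {f : Rd d → 𝕜}
    (hf : LocallyIntegrable f) : Integrable (fun x => φ x • f x) :=
  hf.integrable_smul_left_of_hasCompactSupport hφ.continuous hφ.compact

theorem ae_eq_of_forall_test {f g : Rd d → 𝕜} (hf : LocallyIntegrable f)
    (hg : LocallyIntegrable g)
    (h : ∀ φ : Rd d → ℝ, IsTest φ → ∫ x, φ x • f x = ∫ x, φ x • g x) : f =ᵐ[volume] g := by
  have := ae_eq_zero_of_integral_contDiff_smul_eq_zero (hf.sub hg) (fun φ h1 h2 => by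
    have hφ : IsTest φ := ⟨h1, h2⟩
    have : ∀ x, φ x • (f - g) x = φ x • f x - φ x • g x := fun x => by simp [smul_sub]
    simp only [this]
    rw [integral_sub (hφ.integrable_smul hf) (hφ.integrable_smul hg), h φ hφ, sub_self])
  filter_upwards [this] with x hx
  simpa [sub_eq_zero] using hx

theorem HasWeakDeriv.unique {α : Fin d → ℕ} {f g g' : Rd d → 𝕜} (h : HasWeakDeriv α f g)
    (h' : HasWeakDeriv α f g') : g =ᵐ[volume] g' := by
  refine ae_eq_of_forall_test h.2.1 h'.2.1 fun φ hφ => ?_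
  have h1 := h.2.2 φ hφ.smooth hφ.compact
  rw [h'.2.2 φ hφ.smooth hφ.compact] at h1
  have := congrArg (fun z => (-1 : ℝ) ^ multiLength α • z) h1
  simpa [smul_smul, ← mul_pow] using this.symm

theorem hasWeakDeriv_zero {f : Rd d → 𝕜} (hf : LocallyIntegrable f) : HasWeakDeriv 0 f f :=
  ⟨hf, hf, fun φ _ _ => by simp [multiDeriv_zero]⟩

theorem HasWeakDeriv.congr {α : Fin d → ℕ} {f f' g g' : Rd d → 𝕜} (h : HasWeakDeriv α f g)
    (hf : f =ᵐ[volume] f') (hg : g =ᵐ[volume] g') : HasWeakDeriv α f' g' := by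
  refine ⟨h.1.congr hf, h.2.1.congr hg, fun φ h1 h2 => ?_⟩
  have e1 : ∫ x, multiDeriv α φ x • f' x = ∫ x, multiDeriv α φ x • f x :=
    integral_congr_ae (by filter_upwards [hf] with x hx; rw [hx])
  have e2 : ∫ x, φ x • g' x = ∫ x, φ x • g x :=
    integral_congr_ae (by filter_upwards [hg] with x hx; rw [hx])
  rw [e1, e2]
  exact h.2.2 φ h1 h2

theorem HasWeakDeriv.add {α : Fin d → ℕ} {f f' g g' : Rd d → 𝕜} (h : HasWeakDeriv α f g)
    (h' : HasWeakDeriv α f' g') : HasWeakDeriv α (fun x => f x + f' x) (fun x => g x + g' x) := by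
  refine ⟨h.1.add h'.1, h.2.1.add h'.2.1, fun φ h1 h2 => ?_⟩
  have hφ : IsTest φ := ⟨h1, h2⟩
  simp only [smul_add]
  rw [integral_add ((hφ.multiDeriv α).integrable_smul h.1)
    ((hφ.multiDeriv α).integrable_smul h'.1), h.2.2 φ h1 h2, h'.2.2 φ h1 h2,
    integral_add (hφ.integrable_smul h.2.1) (hφ.integrable_smul h'.2.1), smul_add]

theorem HasWeakDeriv.const_smul {α : Fin d → ℕ} {f g : Rd d → 𝕜} (h : HasWeakDeriv α f g)
    (c : ℝ) : HasWeakDeriv α (fun x => c • f x) (fun x => c • g x) := by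
  refine ⟨h.1.smul c, h.2.1.smul c, fun φ h1 h2 => ?_⟩
  simp only [smul_comm _ c]
  rw [integral_smul, integral_smul, h.2.2 φ h1 h2, smul_comm]

theorem HasWeakDeriv.sub {α : Fin d → ℕ} {f f' g g' : Rd d → 𝕜} (h : HasWeakDeriv α f g)
    (h' : HasWeakDeriv α f' g') : HasWeakDeriv α (fun x => f x - f' x) (fun x => g x - g' x) := by
  have := h.add (h'.const_smul (-1))
  simpa [sub_eq_add_neg] using this

theorem HasWeakDeriv.comp_add_right {α : Fin d → ℕ} {f g : Rd d → 𝕜} (h : HasWeakDeriv α f g)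
    (a : Rd d) : HasWeakDeriv α (fun x => f (x + a)) (fun x => g (x + a)) := by
  have hli : ∀ {u : Rd d → 𝕜}, LocallyIntegrable u → LocallyIntegrable (fun x => u (x + a)) := by
    intro u hu
    refine (locallyIntegrable_map_homeomorph (Homeomorph.addRight a)).1 ?_
    rwa [show Measure.map (Homeomorph.addRight a) (volume : Measure (Rd d)) = volume from
      (measurePreserving_add_right volume a).map_eq]
  have hshift : ∀ (β : Fin d → ℕ) (φ : Rd d → ℝ), IsTest φ →
      multiDeriv β (fun x => φ (-a + (1 : ℝ) • x)) = fun x => multiDeriv β φ (-a + (1 : ℝ) • x) := by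
    intro β
    refine multiIndex_induction (P := fun β => ∀ φ : Rd d → ℝ, IsTest φ →
      multiDeriv β (fun x => φ (-a + (1 : ℝ) • x)) = fun x => multiDeriv β φ (-a + (1 : ℝ) • x))
      (by simp [multiDeriv_zero]) ?_ β
    intro α i ih φ hφ
    rw [multiDeriv_add_single (hφ.comp_affine one_ne_zero _), multiDeriv_add_single hφ,
      ← ih _ (hφ.partialDeriv i)]
    congr 1
    funext x
    rw [partialDeriv_comp_affine hφ, one_mul]
  refine ⟨hli h.1, hli h.2.1, fun φ h1 h2 => ?_⟩
  have hφ : IsTest φ := ⟨h1, h2⟩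
  have hψ := hφ.comp_affine one_ne_zero (-a)
  have h3 := h.2.2 _ hψ.smooth hψ.compact
  rw [hshift α φ hφ, ← integral_add_right_eq_self _ a,
    ← integral_add_right_eq_self (fun x => φ (-a + (1 : ℝ) • x) • g x) a] at h3
  simpa using h3

theorem HasWeakDeriv.trans {α : Fin d → ℕ} {i : Fin d} {f g g' : Rd d → 𝕜}
    (h : HasWeakDeriv α f g) (h' : HasWeakDeriv (Pi.single i 1) g g') :
    HasWeakDeriv (α + Pi.single i 1) f g' := by
  refine ⟨h.1, h'.2.1, fun φ h1 h2 => ?_⟩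
  have hφ : IsTest φ := ⟨h1, h2⟩
  have hφ' := hφ.partialDeriv i
  rw [multiDeriv_add_single hφ, h.2.2 _ hφ'.smooth hφ'.compact, ← multiDeriv_single hφ,
    h'.2.2 φ h1 h2]
  simp [pow_succ]

/-- Testing g against ∂_i φ is, up to sign, testing f against D^α ∂_i φ. A family of weak
derivatives of f can therefore be climbed one first-order step at a time. -/
theorem HasWeakDeriv.of_add {α : Fin d → ℕ} {i : Fin d} {f g g' : Rd d → 𝕜}
    (h : HasWeakDeriv α f g) (h' : HasWeakDeriv (α + Pi.single i 1) f g') :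
    HasWeakDeriv (Pi.single i 1) g g' := by
  refine ⟨h.2.1, h'.2.1, fun φ h1 h2 => ?_⟩
  have hφ : IsTest φ := ⟨h1, h2⟩
  have hφ' := hφ.partialDeriv i
  have e := h'.2.2 φ h1 h2
  rw [multiDeriv_add_single hφ, h.2.2 _ hφ'.smooth hφ'.compact, ← multiDeriv_single hφ] at e
  have := congrArg (fun z => (-1 : ℝ) ^ multiLength α • z) e
  simpa [smul_smul, ← mul_pow, pow_succ, ← mul_assoc] using this

end HolderZygmund

namespace HolderZygmund

variable {d : ℕ} {𝕜 : Type*} [RCLike 𝕜]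

/-! ### Bounded measurable functions and correlations -/

/-- Measurable functions that are bounded everywhere. -/
structure IsBdd (g : Rd d → 𝕜) : Prop where
  meas : StronglyMeasurable g
  bound : ∃ C : ℝ, ∀ x, ‖g x‖ ≤ C

/-- The function `x ↦ ∫ ψ(y) g(x + ty) dy`. -/
noncomputable def corr (ψ : Rd d → ℝ) (t : ℝ) (g : Rd d → 𝕜) (x : Rd d) : 𝕜 :=
  ∫ y, ψ y • g (x + t • y)

theorem eLpNorm_top_le {g : Rd d → 𝕜} {C : ℝ≥0∞} (h : ∀ᵐ x, ‖g x‖ₑ ≤ C) :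
    eLpNorm g ∞ volume ≤ C := by
  rw [eLpNorm_exponent_top]
  exact eLpNormEssSup_le_of_ae_enorm_bound h

theorem ae_le_eLpNorm_top (g : Rd d → 𝕜) : ∀ᵐ x, ‖g x‖ₑ ≤ eLpNorm g ∞ volume := by
  rw [eLpNorm_exponent_top]
  exact ae_le_eLpNormEssSup

theorem IsBdd.sub {g g' : Rd d → 𝕜} (h : IsBdd g) (h' : IsBdd g') :
    IsBdd (fun x => g x - g' x) := by
  obtain ⟨C, hC⟩ := h.bound
  obtain ⟨C', hC'⟩ := h'.bound
  exact ⟨h.meas.sub h'.meas, C + C', fun x => (norm_sub_le _ _).trans (add_le_add (hC x) (hC' x))⟩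

theorem IsBdd.add {g g' : Rd d → 𝕜} (h : IsBdd g) (h' : IsBdd g') :
    IsBdd (fun x => g x + g' x) := by
  obtain ⟨C, hC⟩ := h.bound
  obtain ⟨C', hC'⟩ := h'.bound
  exact ⟨h.meas.add h'.meas, C + C', fun x => (norm_add_le _ _).trans (add_le_add (hC x) (hC' x))⟩

theorem IsBdd.const_smul {g : Rd d → 𝕜} (h : IsBdd g) (c : ℝ) : IsBdd (fun x => c • g x) := by
  obtain ⟨C, hC⟩ := h.bound
  refine ⟨h.meas.const_smul c, ‖c‖ * C, fun x => ?_⟩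
  rw [norm_smul]
  exact mul_le_mul_of_nonneg_left (hC x) (norm_nonneg _)

theorem IsBdd.memLp {g : Rd d → 𝕜} (h : IsBdd g) : MemLp g ∞ volume := by
  obtain ⟨C, hC⟩ := h.bound
  exact memLp_top_of_bound h.meas.aestronglyMeasurable C (Filter.Eventually.of_forall hC)

theorem IsBdd.locallyIntegrable {g : Rd d → 𝕜} (h : IsBdd g) : LocallyIntegrable g :=
  h.memLp.locallyIntegrable le_top

theorem IsBdd.integrable_smul {α : Type*} [MeasurableSpace α] {μ : Measure α} {g : Rd d → 𝕜}
    (h : IsBdd g) {ψ : α → ℝ} (hψ : Integrable ψ μ) {a : α → Rd d} (ha : Measurable a) :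
    Integrable (fun y => ψ y • g (a y)) μ := by
  obtain ⟨C, hC⟩ := h.bound
  exact hψ.smul_bdd C (h.meas.comp_measurable ha).aestronglyMeasurable
    (Filter.Eventually.of_forall fun y => hC _)

theorem measurable_add_smul (x : Rd d) (t : ℝ) : Measurable (fun y : Rd d => x + t • y) := by
  fun_prop

theorem IsBdd.corr {g : Rd d → 𝕜} (h : IsBdd g) {ψ : Rd d → ℝ} (hψ : IsTest ψ) (t : ℝ) :
    IsBdd (corr ψ t g) := by
  refine ⟨?_, ?_⟩
  · refine StronglyMeasurable.integral_prod_right (f := fun x y => ψ y • g (x + t • y)) ?_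
    refine StronglyMeasurable.smul ?_ ?_
    · exact (hψ.continuous.stronglyMeasurable).comp_measurable measurable_snd
    · refine h.meas.comp_measurable ?_
      fun_prop
  · obtain ⟨C, hC⟩ := h.bound
    refine ⟨∫ y, ‖ψ y‖ * C, fun x => ?_⟩
    refine norm_integral_le_of_norm_le (hψ.integrable.norm.mul_const C)
      (Filter.Eventually.of_forall fun y => ?_)
    rw [norm_smul]
    exact mul_le_mul_of_nonneg_left (hC _) (norm_nonneg _)

theorem corr_sub_right {ψ : Rd d → ℝ} (hψ : IsTest ψ) (t : ℝ) {g g' : Rd d → 𝕜} (h : IsBdd g)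
    (h' : IsBdd g') (x : Rd d) :
    corr ψ t (fun z => g z - g' z) x = corr ψ t g x - corr ψ t g' x := by
  simp only [corr, smul_sub]
  exact integral_sub (h.integrable_smul hψ.integrable (measurable_add_smul x t))
    (h'.integrable_smul hψ.integrable (measurable_add_smul x t))

theorem corr_sum_left {ι : Type*} (s : Finset ι) {ψ : ι → Rd d → ℝ} (hψ : ∀ i, IsTest (ψ i))
    (t : ℝ) {g : Rd d → 𝕜} (h : IsBdd g) (x : Rd d) :
    corr (fun y => ∑ i ∈ s, ψ i y) t g x = ∑ i ∈ s, corr (ψ i) t g x := by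
  simp only [corr, Finset.sum_smul]
  exact integral_finsetSum s fun i _ =>
    h.integrable_smul (hψ i).integrable (measurable_add_smul x t)

theorem corr_const_mul (c : ℝ) (ψ : Rd d → ℝ) (t : ℝ) (g : Rd d → 𝕜) (x : Rd d) :
    corr (fun y => c * ψ y) t g x = c • corr ψ t g x := by
  simp only [corr, mul_smul]
  exact integral_smul c _

theorem ae_comp_add_smul {P : Rd d → Prop} (h : ∀ᵐ z, P z) (x : Rd d) {t : ℝ} (ht : t ≠ 0) :
    ∀ᵐ y : Rd d, P (x + t • y) := by
  have h1 : ∀ᵐ z : Rd d, P (x + z) :=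
    (measurePreserving_add_left volume x).quasiMeasurePreserving.ae h
  have h2 : Measure.map (fun y : Rd d => t • y) volume ≪ volume := by
    rw [Measure.map_addHaar_smul _ ht]
    exact Measure.smul_absolutelyContinuous
  exact ae_of_ae_map (p := fun z => P (x + z)) (by fun_prop) (h2.ae_le h1)

theorem enorm_corr_le {ψ : Rd d → ℝ} {t : ℝ} (ht : t ≠ 0) (hψ : IsTest ψ) (g : Rd d → 𝕜)
    (x : Rd d) : ‖corr ψ t g x‖ₑ ≤ (∫⁻ y, ‖ψ y‖ₑ) * eLpNorm g ∞ volume := by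
  refine (enorm_integral_le_lintegral_enorm _).trans ?_
  rw [← lintegral_mul_const _ hψ.continuous.measurable.enorm]
  refine lintegral_mono_ae ?_
  filter_upwards [ae_comp_add_smul (ae_le_eLpNorm_top g) x ht] with y hy
  rw [enorm_smul]
  gcongr

/-- Fubini. Commutation is what makes the difference of two squared operators factor. -/
theorem corr_comm {ψ η : Rd d → ℝ} (hψ : IsTest ψ) (hη : IsTest η) (t s : ℝ) {g : Rd d → 𝕜}
    (hg : IsBdd g) (x : Rd d) : corr ψ t (corr η s g) x = corr η s (corr ψ t g) x := by
  have h1 : ∀ y, ψ y • corr η s g (x + t • y)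
      = ∫ z, (ψ y * η z) • g (x + t • y + s • z) := fun y => by
    simp only [corr, mul_smul]
    exact (integral_smul _ _).symm
  have h2 : ∀ z, η z • corr ψ t g (x + s • z)
      = ∫ y, (ψ y * η z) • g (x + t • y + s • z) := fun z => by
    simp only [corr]
    rw [← integral_smul]
    refine integral_congr_ae (Filter.Eventually.of_forall fun y => ?_)
    simp only [smul_smul, mul_comm (η z)]
    rw [add_right_comm]
  rw [corr, corr]
  simp only [h1, h2]
  refine integral_integral_swap (f := fun y z => (ψ y * η z) • g (x + t • y + s • z)) ?_
  exact hg.integrable_smul (hψ.integrable.mul_prod hη.integrable)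
    (a := fun q : Rd d × Rd d => x + t • q.1 + s • q.2) (by fun_prop)

theorem IsTest.fwdDiff {ψ : Rd d → ℝ} (hψ : IsTest ψ) (h : Rd d) : IsTest (fwdDiff h ψ) := by
  have h1 := hψ.comp_affine one_ne_zero h
  have := h1.add (hψ.const_mul (-1))
  convert this using 1
  funext x
  simp [_root_.fwdDiff, sub_eq_add_neg, add_comm h]

theorem IsTest.fwdDiff_iterate {ψ : Rd d → ℝ} (hψ : IsTest ψ) (h : Rd d) (k : ℕ) :
    IsTest ((_root_.fwdDiff h)^[k] ψ) := by
  induction k with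
  | zero => exact hψ
  | succ k ih => rw [Function.iterate_succ_apply']; exact ih.fwdDiff h

/-- The substitution y ↦ y - h/t moves the difference from g onto the kernel, whose smoothness then
controls it. -/
theorem fwdDiff_corr {ψ : Rd d → ℝ} (hψ : IsTest ψ) {t : ℝ} (ht : t ≠ 0) {g : Rd d → 𝕜}
    (hg : IsBdd g) (h : Rd d) :
    fwdDiff h (corr ψ t g) = corr (fwdDiff (-(t⁻¹ • h)) ψ) t g := by
  funext x
  have h1 : corr ψ t g (x + h) = ∫ y, ψ (y + -(t⁻¹ • h)) • g (x + t • y) := by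
    rw [corr, ← integral_add_right_eq_self _ (-(t⁻¹ • h))]
    refine integral_congr_ae (Filter.Eventually.of_forall fun y => ?_)
    simp only [smul_add, smul_neg, smul_smul, mul_inv_cancel₀ ht, one_smul]
    congr 2
    abel
  have hψ' : IsTest (fun y => ψ (y + -(t⁻¹ • h))) := by
    have := hψ.comp_affine one_ne_zero (-(t⁻¹ • h))
    simpa only [one_smul, add_comm (-(t⁻¹ • h))] using this
  rw [fwdDiff, h1, corr, corr, ← integral_sub
    (hg.integrable_smul hψ'.integrable (measurable_add_smul x t))
    (hg.integrable_smul hψ.integrable (measurable_add_smul x t))]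
  refine integral_congr_ae (Filter.Eventually.of_forall fun y => ?_)
  simp only [fwdDiff, sub_smul]

theorem fwdDiff_iterate_corr {ψ : Rd d → ℝ} (hψ : IsTest ψ) {t : ℝ} (ht : t ≠ 0) {g : Rd d → 𝕜}
    (hg : IsBdd g) (h : Rd d) (k : ℕ) :
    (fwdDiff h)^[k] (corr ψ t g) = corr ((fwdDiff (-(t⁻¹ • h)))^[k] ψ) t g := by
  induction k with
  | zero => rfl
  | succ k ih =>
    rw [Function.iterate_succ_apply', Function.iterate_succ_apply', ih,
      fwdDiff_corr (hψ.fwdDiff_iterate _ _) ht hg]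

/-- The adjoint of a correlation, by Fubini and z = x + ty. It leaves only smooth functions in the
inner integral, where integration by parts is classical. -/
theorem integral_smul_corr {η ψ : Rd d → ℝ} (hη : IsTest η) (hψ : IsTest ψ) (t : ℝ)
    {g : Rd d → 𝕜} (hg : IsBdd g) :
    ∫ x, η x • corr ψ t g x = ∫ z, (∫ y, ψ y * η (z + (-t) • y)) • g z := by
  have h1 : ∀ x, η x • corr ψ t g x = ∫ y, (η x * ψ y) • g (x + t • y) := fun x => by
    simp only [corr, mul_smul]
    exact (integral_smul _ _).symm
  simp only [h1]
  rw [integral_integral_swap (f := fun x y => (η x * ψ y) • g (x + t • y))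
    (hg.integrable_smul (hη.integrable.mul_prod hψ.integrable)
      (a := fun q : Rd d × Rd d => q.1 + t • q.2) (by fun_prop))]
  have h2 : ∀ y, ∫ x, (η x * ψ y) • g (x + t • y) = ∫ z, (ψ y * η (z + (-t) • y)) • g z := by
    intro y
    rw [← integral_add_right_eq_self (fun z => (ψ y * η (z + (-t) • y)) • g z) (t • y)]
    refine integral_congr_ae (Filter.Eventually.of_forall fun x => ?_)
    simp [mul_comm]
  simp only [h2]
  have hprod : Integrable (fun q : Rd d × Rd d => ψ q.1 * η (q.2 + (-t) • q.1))
      (volume.prod volume) := by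
    have hm : AEStronglyMeasurable (fun q : Rd d × Rd d => ψ q.1 * η (q.2 + (-t) • q.1))
        (volume.prod volume) := by
      refine Continuous.aestronglyMeasurable ?_
      have h1 := hψ.continuous
      have h2 := hη.continuous
      fun_prop
    rw [integrable_prod_iff hm]
    refine ⟨Filter.Eventually.of_forall fun y => ?_, ?_⟩
    · exact (hη.integrable.comp_add_right ((-t) • y)).const_mul (ψ y)
    · have : (fun y => ∫ z, ‖ψ y * η (z + (-t) • y)‖) = fun y => ‖ψ y‖ * ∫ z, ‖η z‖ := by
        funext y
        simp only [norm_mul]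
        rw [integral_const_mul, integral_add_right_eq_self (fun z => ‖η z‖)]
      change Integrable (fun y => ∫ z, ‖ψ y * η (z + (-t) • y)‖) _
      rw [this]
      exact hψ.integrable.norm.mul_const _
  rw [integral_integral_swap (f := fun y z => (ψ y * η (z + (-t) • y)) • g z)
    (hg.integrable_smul hprod measurable_snd)]
  refine integral_congr_ae (Filter.Eventually.of_forall fun z => ?_)
  exact integral_smul_const _ _

theorem hasWeakDeriv_single_corr {ψ : Rd d → ℝ} (hψ : IsTest ψ) {t : ℝ} (ht : t ≠ 0)
    {g : Rd d → 𝕜} (hg : IsBdd g) (i : Fin d) :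
    HasWeakDeriv (Pi.single i 1) (corr ψ t g)
      (fun x => (-t⁻¹) • corr (partialDeriv i ψ) t g x) := by
  refine ⟨(hg.corr hψ t).locallyIntegrable,
    ((hg.corr (hψ.partialDeriv i) t).const_smul _).locallyIntegrable, fun η h1 h2 => ?_⟩
  have hη : IsTest η := ⟨h1, h2⟩
  rw [multiDeriv_single hη]
  simp only [smul_comm _ (-t⁻¹)]
  rw [integral_smul, integral_smul_corr (hη.partialDeriv i) hψ t hg,
    integral_smul_corr hη (hψ.partialDeriv i) t hg, multiLength_single, smul_smul, ← integral_smul]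
  refine integral_congr_ae (Filter.Eventually.of_forall fun z => ?_)
  simp only [smul_smul]
  congr 1
  -- Integration by parts in y between ψ(y) and η(z - ty); the chain rule contributes the factor -t,
  -- hence the -1/t in the derivative.
  have h3 := integral_mul_partialDeriv hψ (hη.comp_affine (neg_ne_zero.2 ht) z) i
  simp only [partialDeriv_comp_affine hη] at h3
  have h4 : ∫ x, ψ x * (-t * partialDeriv i η (z + -t • x))
      = -t * ∫ x, ψ x * partialDeriv i η (z + -t • x) := by
    rw [← integral_const_mul]
    refine integral_congr_ae (Filter.Eventually.of_forall fun z => ?_)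
    ring
  rw [h4] at h3
  field_simp
  linarith

theorem hasWeakDeriv_corr {ψ : Rd d → ℝ} (hψ : IsTest ψ) {t : ℝ} (ht : t ≠ 0)
    {g : Rd d → 𝕜} (hg : IsBdd g) (α : Fin d → ℕ) :
    HasWeakDeriv α (corr ψ t g)
      (fun x => (-t⁻¹) ^ multiLength α • corr (multiDeriv α ψ) t g x) := by
  induction α using multiIndex_induction with
  | h0 =>
    simpa [multiDeriv_zero] using hasWeakDeriv_zero (hg.corr hψ t).locallyIntegrable
  | h1 α i ih =>
    have := ih.trans ((hasWeakDeriv_single_corr (hψ.multiDeriv α) ht hg i).const_smul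
      ((-t⁻¹) ^ multiLength α))
    simpa [partialDeriv_multiDeriv hψ, smul_smul, pow_succ] using this

/-! ### Integral bounds for differences of test functions -/

/-- Mean value inequality: the (k+1)-st difference of ψ is the increment of its k-th difference,
whose derivative is the k-th difference of `fderiv ℝ ψ`. The target space is arbitrary because the
induction passes from ψ to `fderiv ℝ ψ`. -/
theorem exists_norm_fwdDiff_iterate_le (k : ℕ) : ∀ {E : Type} [NormedAddCommGroup E]
    [NormedSpace ℝ E] {ψ : Rd d → E}, ContDiff ℝ ((⊤ : ℕ∞) : WithTop ℕ∞) ψ →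
    HasCompactSupport ψ → ∃ C : ℝ, 0 ≤ C ∧ ∀ h x, ‖(fwdDiff h)^[k] ψ x‖ ≤ C * ‖h‖ ^ k := by
  induction k with
  | zero =>
    intro E _ _ ψ h1 h2
    obtain ⟨C, hC⟩ := h1.continuous.bounded_above_of_compact_support h2
    exact ⟨C, (norm_nonneg _).trans (hC 0), fun h x => by simpa using hC x⟩
  | succ k ih =>
    intro E _ _ ψ h1 h2
    have hf : ContDiff ℝ ((⊤ : ℕ∞) : WithTop ℕ∞) (fderiv ℝ ψ) := h1.fderiv_right (by simp)
    obtain ⟨C, hC0, hC⟩ := ih hf (h2.fderiv (𝕜 := ℝ))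
    refine ⟨C, hC0, fun h x => ?_⟩
    have hd : ∀ j : ℕ, ∀ y, HasFDerivAt ((fwdDiff h)^[j] ψ) ((fwdDiff h)^[j] (fderiv ℝ ψ) y) y := by
      intro j
      induction j with
      | zero => exact fun y => (h1.differentiable (by simp) y).hasFDerivAt
      | succ j ihj =>
        intro y
        rw [Function.iterate_succ_apply', Function.iterate_succ_apply']
        have : HasFDerivAt (fun z => (fwdDiff h)^[j] ψ (z + h))
            ((fwdDiff h)^[j] (fderiv ℝ ψ) (y + h)) y := by
          exact (hasFDerivAt_comp_add_right h).2 (ihj (y + h))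
        exact this.sub (ihj y)
    rw [Function.iterate_succ_apply', fwdDiff]
    have := Convex.norm_image_sub_le_of_norm_hasFDerivWithin_le (s := Set.univ)
      (fun y _ => (hd k y).hasFDerivWithinAt) (fun y _ => hC h y) convex_univ
      (Set.mem_univ x) (Set.mem_univ (x + h))
    simpa [pow_succ, mul_assoc] using this

/-- The binomial expansion bounds the integral uniformly in h. For small h, the difference is of
size |h|^k and lives on k + 1 translates of the support of ψ, of fixed total volume. -/
theorem exists_lintegral_fwdDiff_iterate_le {ψ : Rd d → ℝ} (hψ : IsTest ψ) (k : ℕ) :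
    ∃ C : ℝ≥0∞, C ≠ ∞ ∧ ∀ h, ∫⁻ x, ‖(fwdDiff h)^[k] ψ x‖ₑ ≤ C * min 1 (‖h‖ₑ ^ k) := by
  obtain ⟨C, hC0, hC⟩ := exists_norm_fwdDiff_iterate_le k hψ.smooth hψ.compact
  have hvol : volume (tsupport ψ) ≠ ∞ := hψ.compact.isCompact.measure_lt_top.ne
  have hmeas : MeasurableSet (tsupport ψ) := (isClosed_tsupport ψ).measurableSet
  set A : ℝ≥0∞ := ∑ _j ∈ Finset.range (k + 1), ENNReal.ofReal C * volume (tsupport ψ) with hA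
  set B : ℝ≥0∞ := ∑ j ∈ Finset.range (k + 1),
    ‖((-1 : ℤ) ^ (k - j) * (k.choose j : ℤ) : ℤ)‖ₑ * ∫⁻ x, ‖ψ x‖ₑ with hB
  have hψi : ∫⁻ x, ‖ψ x‖ₑ ≠ ∞ := hψ.integrable.2.ne
  refine ⟨A + B, ?_, fun h => ?_⟩
  · refine ENNReal.add_ne_top.2 ⟨?_, ?_⟩
    · exact ENNReal.sum_ne_top.2 fun _ _ => ENNReal.mul_ne_top ENNReal.ofReal_ne_top hvol
    · exact ENNReal.sum_ne_top.2 fun _ _ => ENNReal.mul_ne_top enorm_ne_top hψi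
  have h1 : ∫⁻ x, ‖(fwdDiff h)^[k] ψ x‖ₑ ≤ B := by
    calc ∫⁻ x, ‖(fwdDiff h)^[k] ψ x‖ₑ
        ≤ ∫⁻ x, ∑ j ∈ Finset.range (k + 1),
          ‖((-1 : ℤ) ^ (k - j) * (k.choose j : ℤ) : ℤ)‖ₑ * ‖ψ (x + j • h)‖ₑ := by
          refine lintegral_mono fun x => ?_
          rw [fwdDiff_iter_eq_sum_shift]
          refine (enorm_sum_le _ _).trans (Finset.sum_le_sum fun j _ => ?_)
          rw [zsmul_eq_mul, enorm_mul]
          gcongr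
          simp [enorm_eq_nnnorm]
      _ = B := by
          have hm : ∀ j : ℕ, Measurable (fun x => ‖ψ (x + j • h)‖ₑ) := fun j =>
            (hψ.continuous.comp (continuous_add_const (j • h))).measurable.enorm
          rw [lintegral_finsetSum _ fun j _ => (hm j).const_mul _]
          refine Finset.sum_congr rfl fun j _ => ?_
          rw [lintegral_const_mul' _ _ enorm_ne_top,
            lintegral_add_right_eq_self (fun x => ‖ψ x‖ₑ)]
  have h2 : ∫⁻ x, ‖(fwdDiff h)^[k] ψ x‖ₑ ≤ A * ‖h‖ₑ ^ k := by
    calc ∫⁻ x, ‖(fwdDiff h)^[k] ψ x‖ₑ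
        ≤ ∫⁻ x, ∑ j ∈ Finset.range (k + 1),
          (tsupport ψ).indicator (fun _ => ENNReal.ofReal C * ‖h‖ₑ ^ k) (x + j • h) := by
          refine lintegral_mono fun x => ?_
          by_cases hx : ∃ j ∈ Finset.range (k + 1), x + j • h ∈ tsupport ψ
          · obtain ⟨j, hj, hxj⟩ := hx
            refine le_trans ?_ (Finset.single_le_sum (f := fun j => (tsupport ψ).indicator
              (fun _ => ENNReal.ofReal C * ‖h‖ₑ ^ k) (x + j • h)) (fun _ _ => zero_le) hj)
            simp only [Set.indicator_of_mem hxj]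
            rw [← ofReal_norm, ← ofReal_norm, ← ENNReal.ofReal_pow (norm_nonneg _),
              ← ENNReal.ofReal_mul hC0]
            exact ENNReal.ofReal_le_ofReal (hC h x)
          · push Not at hx
            rw [fwdDiff_iter_eq_sum_shift, Finset.sum_eq_zero]
            · simp
            · intro j hj
              rw [image_eq_zero_of_notMem_tsupport (hx j hj), smul_zero]
      _ = A * ‖h‖ₑ ^ k := by
          have hme : Measurable ((tsupport ψ).indicator
              (fun _ => ENNReal.ofReal C * ‖h‖ₑ ^ k)) := measurable_const.indicator hmeas
          rw [lintegral_finsetSum _ fun j _ => by fun_prop, hA, Finset.sum_mul]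
          refine Finset.sum_congr rfl fun j _ => ?_
          rw [lintegral_add_right_eq_self ((tsupport ψ).indicator
              (fun _ => ENNReal.ofReal C * ‖h‖ₑ ^ k)), lintegral_indicator hmeas,
              setLIntegral_const]
          ring
  rcases le_total 1 (‖h‖ₑ ^ k) with h3 | h3
  · rw [min_eq_left h3, mul_one]
    exact h1.trans le_add_self
  · rw [min_eq_right h3]
    exact h2.trans (mul_le_mul_left le_self_add _)

end HolderZygmund

namespace HolderZygmund

variable {d : ℕ} {𝕜 : Type*} [RCLike 𝕜]

/-! ### Differences of bounded functions -/

theorem stronglyMeasurable_fwdDiff_iterate {f : Rd d → 𝕜} (hf : StronglyMeasurable f) (m : ℕ) :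
    StronglyMeasurable (fun q : Rd d × Rd d => (fwdDiff q.1)^[m] f q.2) := by
  simp only [fwdDiff_iter_eq_sum_shift]
  refine Finset.stronglyMeasurable_fun_sum _ fun k _ => ?_
  exact (hf.comp_measurable (g := fun q : Rd d × Rd d => q.2 + k • q.1) (by fun_prop)).const_smul
    (_ : ℤ)

/-- The essential supremum exceeds a exactly when the section at h of a measurable set in the
product space has positive measure, and the measure of a section is measurable in h. -/
theorem measurable_eLpNorm_fwdDiff {f : Rd d → 𝕜} (hf : StronglyMeasurable f) (m : ℕ) :
    Measurable (fun h : Rd d => eLpNorm ((fwdDiff h)^[m] f) ∞ volume) := by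
  refine measurable_of_Ioi fun a => ?_
  have hF := (stronglyMeasurable_fwdDiff_iterate hf m).enorm
  have hs : MeasurableSet {q : Rd d × Rd d | a < ‖(fwdDiff q.1)^[m] f q.2‖ₑ} :=
    measurableSet_lt measurable_const hF
  have h1 := measurable_measure_prodMk_left (ν := (volume : Measure (Rd d))) hs
  convert (h1 (measurableSet_singleton (0 : ℝ≥0∞))).compl using 1
  ext h
  simp only [Set.mem_preimage, Set.mem_Ioi, Set.mem_compl_iff, Set.mem_singleton_iff]
  rw [← not_iff_not, not_lt, not_not]
  have h2 : volume (Prod.mk h ⁻¹' {q : Rd d × Rd d | a < ‖(fwdDiff q.1)^[m] f q.2‖ₑ}) = 0 ↔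
      ∀ᵐ x, ‖(fwdDiff h)^[m] f x‖ₑ ≤ a := by
    rw [ae_iff]
    simp only [not_le]
    rfl
  rw [h2]
  refine ⟨fun h3 => ?_, eLpNorm_top_le⟩
  filter_upwards [ae_le_eLpNorm_top ((fwdDiff h)^[m] f)] with x hx using hx.trans h3

theorem fwdDiff_iterate_congr {f g : Rd d → 𝕜} (hfg : f =ᵐ[volume] g) (h : Rd d) (m : ℕ) :
    (fwdDiff h)^[m] f =ᵐ[volume] (fwdDiff h)^[m] g := by
  induction m with
  | zero => exact hfg
  | succ m ih =>
    rw [Function.iterate_succ_apply', Function.iterate_succ_apply']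
    have h1 := (measurePreserving_add_right (volume : Measure (Rd d)) h).quasiMeasurePreserving.ae ih
    filter_upwards [ih, h1] with x hx hx'
    simp only [fwdDiff]
    rw [hx, hx']

theorem diffNorm_congr {f g : Rd d → 𝕜} (hfg : f =ᵐ[volume] g) (γ : ℝ) :
    diffNorm γ f = diffNorm γ g := by
  funext h
  exact eLpNorm_congr_ae (fwdDiff_iterate_congr hfg h _)

theorem zygmundSeminorm_congr {f g : Rd d → 𝕜} (hfg : f =ᵐ[volume] g) (γ : ℝ) (p : ℝ≥0∞) :
    zygmundSeminorm γ p f = zygmundSeminorm γ p g := by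
  simp only [zygmundSeminorm, diffNorm_congr hfg]

theorem zygmundNorm_congr {f g : Rd d → 𝕜} (hfg : f =ᵐ[volume] g) (γ : ℝ) (p : ℝ≥0∞) :
    zygmundNorm γ p f = zygmundNorm γ p g := by
  simp only [zygmundNorm, zygmundSeminorm_congr hfg, eLpNorm_congr_ae hfg]

theorem measurable_diffNorm {f : Rd d → 𝕜} (hf : AEStronglyMeasurable f volume) (γ : ℝ) :
    Measurable (diffNorm γ f) := by
  rw [diffNorm_congr hf.ae_eq_mk γ]
  exact measurable_eLpNorm_fwdDiff hf.stronglyMeasurable_mk _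

/-- The measurable representative is cut off where it exceeds the essential supremum. Correlations
and their bounds then hold at every point, while the norms and weak derivatives do not see the
change. -/
theorem exists_isBdd_ae_eq {f : Rd d → 𝕜} (hf : MemLp f ∞ volume) :
    ∃ g : Rd d → 𝕜, IsBdd g ∧ f =ᵐ[volume] g := by
  set u := hf.1.mk f
  set C := (eLpNorm f ∞ volume).toReal
  refine ⟨Set.indicator {x | ‖u x‖ ≤ C} u, ⟨?_, C, fun x => ?_⟩, ?_⟩
  · exact hf.1.stronglyMeasurable_mk.indicator
      (hf.1.stronglyMeasurable_mk.norm.measurable measurableSet_Iic)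
  · by_cases hx : ‖u x‖ ≤ C
    · rwa [Set.indicator_of_mem (by exact hx)]
    · rw [Set.indicator_of_notMem (by exact hx), norm_zero]
      exact ENNReal.toReal_nonneg
  · filter_upwards [hf.1.ae_eq_mk, ae_le_eLpNorm_top f] with x hx hx'
    have h1 : ‖u x‖ ≤ C := by
      change ‖hf.1.mk f x‖ ≤ C
      rw [← hx]
      rw [← ofReal_norm] at hx'
      exact (ENNReal.ofReal_le_iff_le_toReal hf.2.ne).1 hx'
    rw [Set.indicator_of_mem (by exact h1), hx]

/-! ### The approximating kernel -/

/-- A smooth bump function supported in the unit ball, with integral one. -/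
noncomputable def stdBump (d : ℕ) : Rd d → ℝ :=
  (⟨1 / 2, 1, by norm_num, by norm_num⟩ : ContDiffBump (0 : Rd d)).normed volume

theorem isTest_stdBump : IsTest (stdBump d) :=
  ⟨ContDiffBump.contDiff_normed _, ContDiffBump.hasCompactSupport_normed _⟩

theorem integral_stdBump : ∫ x, stdBump d x = 1 := ContDiffBump.integral_normed _

theorem stdBump_eq_zero {x : Rd d} (hx : x ∉ Metric.ball (0 : Rd d) 1) : stdBump d x = 0 := by
  by_contra h
  refine hx ?_
  have : x ∈ Function.support (stdBump d) := h
  rwa [stdBump, ContDiffBump.support_normed_eq] at this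

/-- The kernel whose correlation reproduces `f` up to an average of the differences of order `m`. -/
noncomputable def diffKernel (d m : ℕ) (y : Rd d) : ℝ :=
  ∑ k ∈ Finset.range m, ((-1) ^ k * (m.choose (k + 1) : ℝ)) *
    ((((k + 1 : ℕ) : ℝ) ^ d)⁻¹ * stdBump d ((0 : Rd d) + (((k + 1 : ℕ) : ℝ)⁻¹) • y))

theorem isTest_dilate {ψ : Rd d → ℝ} (hψ : IsTest ψ) {c : ℝ} (hc : 0 < c) :
    IsTest (fun y : Rd d => (c ^ d)⁻¹ * ψ ((0 : Rd d) + c⁻¹ • y)) :=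
  (hψ.comp_affine (inv_ne_zero hc.ne') 0).const_mul _

theorem corr_dilate {ψ : Rd d → ℝ} {c : ℝ} (hc : 0 < c) (t : ℝ)
    (g : Rd d → 𝕜) (x : Rd d) :
    corr (fun y : Rd d => (c ^ d)⁻¹ * ψ ((0 : Rd d) + c⁻¹ • y)) t g x = corr ψ (t * c) g x := by
  rw [corr_const_mul]
  have := Measure.integral_comp_smul (volume : Measure (Rd d))
    (fun y => ψ y • g (x + (t * c) • y)) c⁻¹
  have h2 : ∀ y : Rd d, (t * c) • c⁻¹ • y = t • y := fun y => by
    rw [smul_smul, mul_assoc, mul_inv_cancel₀ hc.ne', mul_one]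
  simp only [h2, finrank_euclideanSpace, Fintype.card_fin] at this
  simp only [corr, zero_add]
  rw [this, smul_smul, abs_of_pos (by positivity), inv_pow, inv_inv, inv_mul_cancel₀ (by positivity),
    one_smul]

theorem isTest_diffKernel (m : ℕ) : IsTest (diffKernel d m) := by
  refine IsTest.sum _ fun k _ => IsTest.const_mul ?_ _
  exact isTest_dilate isTest_stdBump (by positivity)

/-- Expanding the m-th difference binomially, the unshifted term is ±f(x) because the bump has
integral one, and the term shifted by kty is a correlation at scale tk, that is, with the bump
dilated by k. The kernel collects the terms with k ≥ 1. -/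
theorem sub_corr_diffKernel {f : Rd d → 𝕜} (hf : IsBdd f) (m : ℕ) (t : ℝ) (x : Rd d) :
    f x - corr (diffKernel d m) t f x
      = (-1 : ℝ) ^ m • ∫ y, stdBump d y • (fwdDiff (t • y))^[m] f x := by
  have hi : ∀ k : ℕ, Integrable (fun y => stdBump d y • f (x + k • t • y)) := fun k =>
    hf.integrable_smul isTest_stdBump.integrable (by fun_prop)
  have h1 : ∫ y, stdBump d y • (fwdDiff (t • y))^[m] f x
      = ∑ k ∈ Finset.range (m + 1),
        ((-1 : ℝ) ^ (m - k) * (m.choose k : ℝ)) • corr (stdBump d) (t * k) f x := by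
    simp only [fwdDiff_iter_eq_sum_shift, Finset.smul_sum]
    have h2 : ∀ k : ℕ, ∀ y, stdBump d y • ((-1 : ℤ) ^ (m - k) * (m.choose k : ℤ)) • f (x + k • t • y)
        = ((-1 : ℝ) ^ (m - k) * (m.choose k : ℝ)) • (stdBump d y • f (x + k • t • y)) := by
      intro k y
      rw [smul_comm, ← Int.cast_smul_eq_zsmul ℝ]
      push_cast
      rfl
    simp only [h2]
    rw [integral_finsetSum _ fun k _ => (hi k).fun_smul _]
    refine Finset.sum_congr rfl fun k _ => ?_
    rw [integral_smul, corr]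
    congr 2
    funext y
    rw [← Nat.cast_smul_eq_nsmul ℝ, smul_smul, mul_comm]
  have h0 : corr (stdBump d) (t * (0 : ℕ)) f x = f x := by
    simp only [corr, Nat.cast_zero, mul_zero, zero_smul, add_zero]
    rw [integral_smul_const, integral_stdBump, one_smul]
  have hK : corr (diffKernel d m) t f x = ∑ k ∈ Finset.range m,
      ((-1 : ℝ) ^ k * (m.choose (k + 1) : ℝ)) • corr (stdBump d) (t * (k + 1 : ℕ)) f x := by
    have := corr_sum_left (Finset.range m) (ψ := fun k y => ((-1) ^ k * (m.choose (k + 1) : ℝ)) *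
      ((((k + 1 : ℕ) : ℝ) ^ d)⁻¹ * stdBump d ((0 : Rd d) + (((k + 1 : ℕ) : ℝ)⁻¹) • y)))
      (fun k => (isTest_dilate isTest_stdBump (by positivity)).const_mul _) t hf x
    refine this.trans (Finset.sum_congr rfl fun k _ => ?_)
    rw [corr_const_mul, corr_dilate (by positivity)]
  rw [h1, hK, Finset.sum_range_succ', h0, smul_add, smul_smul, Finset.smul_sum, sub_eq_add_neg,
    add_comm, ← Finset.sum_neg_distrib]
  congr 1
  · refine Finset.sum_congr rfl fun k hk => ?_
    rw [smul_smul, ← neg_smul, ← mul_assoc, ← neg_mul]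
    congr 2
    -- With m = k + 1 + l the sign is (-1)^{k+1+2l}, so the dependence on m disappears.
    have : k + 1 ≤ m := Finset.mem_range.1 hk
    obtain ⟨l, rfl⟩ := Nat.exists_eq_add_of_le this
    rw [Nat.add_sub_cancel_left, pow_add, mul_assoc, ← pow_add, Even.neg_one_pow ⟨l, rfl⟩]
    ring
  · simp [← pow_add, Even.neg_one_pow ⟨m, rfl⟩]

/-! ### Local averages of the differences and the approximation error -/

theorem lintegral_comp_smul (F : Rd d → ℝ≥0∞) {t : ℝ} (ht : 0 < t) :
    ∫⁻ y, F (t • y) = ENNReal.ofReal ((t ^ d)⁻¹) * ∫⁻ y, F y := by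
  have h2 : ∫⁻ y, F (t • y) = ∫⁻ y, F y ∂(Measure.map (fun y : Rd d => t • y) volume) :=
    (lintegral_map_equiv F (Homeomorph.smulOfNeZero t ht.ne' : Rd d ≃ₜ Rd d).toMeasurableEquiv).symm
  rw [h2, Measure.map_addHaar_smul _ ht.ne', lintegral_smul_measure, finrank_euclideanSpace,
    Fintype.card_fin, abs_of_pos (by positivity), smul_eq_mul]

/-- The local average `t^{-d} ∫_{|h| < t} w(h) dh`. -/
noncomputable def ballAvg (w : Rd d → ℝ≥0∞) (t : ℝ) : ℝ≥0∞ :=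
  ENNReal.ofReal ((t ^ d)⁻¹) * ∫⁻ h in Metric.ball (0 : Rd d) t, w h

theorem setLIntegral_ball_comp_smul (w : Rd d → ℝ≥0∞) {t : ℝ} (ht : 0 < t) :
    ∫⁻ y in Metric.ball (0 : Rd d) 1, w (t • y) = ballAvg w t := by
  rw [ballAvg, ← lintegral_indicator Metric.isOpen_ball.measurableSet,
    ← lintegral_indicator Metric.isOpen_ball.measurableSet, ← lintegral_comp_smul _ ht]
  refine lintegral_congr fun y => ?_
  have : t • y ∈ Metric.ball (0 : Rd d) t ↔ y ∈ Metric.ball (0 : Rd d) 1 := by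
    simp only [mem_ball_zero_iff, norm_smul, Real.norm_of_nonneg ht.le]
    exact mul_lt_iff_lt_one_right ht
  by_cases hy : y ∈ Metric.ball (0 : Rd d) 1
  · rw [Set.indicator_of_mem hy, Set.indicator_of_mem (this.2 hy)]
  · rw [Set.indicator_of_notMem hy, Set.indicator_of_notMem (fun h => hy (this.1 h))]

theorem exists_stdBump_bound (d : ℕ) : ∃ C : ℝ≥0∞, C ≠ ∞ ∧ ∀ y, ‖stdBump d y‖ₑ ≤ C := by
  obtain ⟨C, hC⟩ := (isTest_stdBump (d := d)).continuous.bounded_above_of_compact_support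
    isTest_stdBump.compact
  refine ⟨ENNReal.ofReal C, ENNReal.ofReal_ne_top, fun y => ?_⟩
  rw [← ofReal_norm]
  exact ENNReal.ofReal_le_ofReal (hC y)

theorem eLpNorm_sub_corr_diffKernel_le {C : ℝ≥0∞} (hC : ∀ y, ‖stdBump d y‖ₑ ≤ C) (hCt : C ≠ ∞)
    {f : Rd d → 𝕜} (hf : IsBdd f) (m : ℕ) {t : ℝ} (ht : 0 < t) :
    eLpNorm (fun x => f x - corr (diffKernel d m) t f x) ∞ volume
      ≤ C * ballAvg (fun h => eLpNorm ((fwdDiff h)^[m] f) ∞ volume) t := by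
  set w : Rd d → ℝ≥0∞ := fun h => eLpNorm ((fwdDiff h)^[m] f) ∞ volume with hw
  -- The exceptional null set of x depends on y; joint measurability allows the two
  -- almost-everywhere quantifiers to be exchanged.
  have hae : ∀ᵐ x : Rd d, ∀ᵐ y : Rd d, ‖(fwdDiff (t • y))^[m] f x‖ₑ ≤ w (t • y) := by
    rw [Measure.ae_ae_comm (p := fun x y : Rd d => ‖(fwdDiff (t • y))^[m] f x‖ₑ ≤ w (t • y))]
    · exact Filter.Eventually.of_forall fun y => ae_le_eLpNorm_top _
    · refine measurableSet_le ?_ ?_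
      · exact ((stronglyMeasurable_fwdDiff_iterate hf.meas m).comp_measurable
          (g := fun q : Rd d × Rd d => (t • q.2, q.1)) (by fun_prop)).enorm
      · exact (measurable_eLpNorm_fwdDiff hf.meas m).comp (by fun_prop)
  refine eLpNorm_top_le ?_
  filter_upwards [hae] with x hx
  rw [sub_corr_diffKernel hf, enorm_smul]
  have h1 : ‖(-1 : ℝ) ^ m‖ₑ = 1 := by simp
  rw [h1, one_mul]
  refine (enorm_integral_le_lintegral_enorm _).trans ?_
  rw [← setLIntegral_ball_comp_smul w ht, ← lintegral_const_mul' _ _ hCt,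
    ← lintegral_indicator Metric.isOpen_ball.measurableSet]
  refine lintegral_mono_ae ?_
  filter_upwards [hx] with y hy
  by_cases hyb : y ∈ Metric.ball (0 : Rd d) 1
  · rw [Set.indicator_of_mem hyb, enorm_smul]
    exact mul_le_mul' (hC y) hy
  · rw [stdBump_eq_zero hyb]
    simp

theorem ballAvg_half_le (w : Rd d → ℝ≥0∞) {t : ℝ} (ht : 0 < t) :
    ballAvg w (t / 2) ≤ 2 ^ d * ballAvg w t := by
  rw [ballAvg, ballAvg, ← mul_assoc]
  gcongr
  · rw [div_pow, inv_div, div_eq_mul_inv, ENNReal.ofReal_mul (by positivity)]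
    gcongr
    simp
  · exact half_le_self ht.le

/-! ### Weak derivatives of limits -/

theorem enorm_integral_smul_le {φ : Rd d → ℝ} (hφ : IsTest φ) (g : Rd d → 𝕜) :
    ‖∫ x, φ x • g x‖ₑ ≤ (∫⁻ x, ‖φ x‖ₑ) * eLpNorm g ∞ volume := by
  refine (enorm_integral_le_lintegral_enorm _).trans ?_
  rw [← lintegral_mul_const _ hφ.continuous.measurable.enorm]
  refine lintegral_mono_ae ?_
  filter_upwards [ae_le_eLpNorm_top g] with x hx
  rw [enorm_smul]
  gcongr

theorem tendsto_integral_smul {φ : Rd d → ℝ} (hφ : IsTest φ) {u : ℕ → Rd d → 𝕜} {F : Rd d → 𝕜}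
    (hu : ∀ j, LocallyIntegrable (u j)) (hF : LocallyIntegrable F)
    (h : Filter.Tendsto (fun j => eLpNorm (fun x => u j x - F x) ∞ volume) Filter.atTop (nhds 0)) :
    Filter.Tendsto (fun j => ∫ x, φ x • u j x) Filter.atTop (nhds (∫ x, φ x • F x)) := by
  rw [tendsto_iff_edist_tendsto_0]
  have hlim : Filter.Tendsto (fun j => (∫⁻ x, ‖φ x‖ₑ) * eLpNorm (fun x => u j x - F x) ∞ volume)
      Filter.atTop (nhds 0) := by
    have := ENNReal.Tendsto.const_mul h (Or.inr hφ.integrable.2.ne) (a := ∫⁻ x, ‖φ x‖ₑ)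
    rwa [mul_zero] at this
  refine tendsto_of_tendsto_of_tendsto_of_le_of_le tendsto_const_nhds hlim
    (fun _ => zero_le) fun j => ?_
  simp only
  rw [edist_eq_enorm_sub, ← integral_sub (hφ.integrable_smul (hu j)) (hφ.integrable_smul hF)]
  simp only [← smul_sub]
  exact enorm_integral_smul_le hφ _

theorem HasWeakDeriv.of_tendsto {α : Fin d → ℕ} {u v : ℕ → Rd d → 𝕜} {F G : Rd d → 𝕜}
    (h : ∀ j, HasWeakDeriv α (u j) (v j)) (hF : LocallyIntegrable F) (hG : LocallyIntegrable G)
    (hu : Filter.Tendsto (fun j => eLpNorm (fun x => u j x - F x) ∞ volume) Filter.atTop (nhds 0))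
    (hv : Filter.Tendsto (fun j => eLpNorm (fun x => v j x - G x) ∞ volume) Filter.atTop (nhds 0)) :
    HasWeakDeriv α F G := by
  refine ⟨hF, hG, fun φ h1 h2 => ?_⟩
  have hφ : IsTest φ := ⟨h1, h2⟩
  refine tendsto_nhds_unique
    (tendsto_integral_smul (hφ.multiDeriv α) (fun j => (h j).1) hF hu) ?_
  simp only [fun j => (h j).2.2 φ h1 h2]
  exact (tendsto_integral_smul hφ (fun j => (h j).2.1) hG hv).const_smul _

end HolderZygmund

namespace HolderZygmund

variable {d : ℕ}

/-! ### Dyadic sums and Hardy-type inequalities -/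

/-- The weight `min(r, 1/r)^a`. -/
noncomputable def dyadicWeight (a : ℝ) (r : ℝ≥0∞) : ℝ≥0∞ := min r r⁻¹ ^ a

theorem measurable_dyadicWeight (a : ℝ) : Measurable (dyadicWeight a) := by
  unfold dyadicWeight
  fun_prop

theorem two_zpow_mul_le {i : ℤ} {r : ℝ≥0∞} (h1 : (2 : ℝ≥0∞) ^ i ≤ r)
    (h2 : r ≤ (2 : ℝ≥0∞) ^ (i + 1)) : min r r⁻¹ ≤ 2 * (2⁻¹ : ℝ≥0∞) ^ i.natAbs := by
  rcases Int.natAbs_eq i with h | h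
  · refine (min_le_right _ _).trans ?_
    rw [← ENNReal.inv_pow]
    refine (ENNReal.inv_le_inv.2 ?_).trans (le_mul_of_one_le_left (by simp) (by norm_num))
    rwa [h, zpow_natCast] at h1
  · refine (min_le_left _ _).trans (h2.trans ?_)
    rw [ENNReal.zpow_add (by norm_num) (by norm_num), zpow_one, mul_comm]
    conv_lhs => rw [h]
    rw [ENNReal.zpow_neg, zpow_natCast, ← ENNReal.inv_pow]

/-- Locating s between consecutive powers of two compares the sum with the two-sided geometric
series of 2^{-a|i|}, i ∈ ℤ, uniformly in s. -/
theorem exists_tsum_dyadicWeight_le {a : ℝ} (ha : 0 < a) :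
    ∃ C : ℝ≥0∞, C ≠ ∞ ∧ ∀ s : ℝ≥0∞, s ≠ 0 → s ≠ ∞ →
      ∑' j : ℕ, dyadicWeight a (2 ^ j * s) ≤ C := by
  set x : ℝ≥0∞ := (2⁻¹ : ℝ≥0∞) ^ a with hx
  have hx1 : x < 1 := ENNReal.rpow_lt_one (by simp) ha
  have hs : ∑' n : ℕ, x ^ n ≠ ∞ := by
    rw [ENNReal.tsum_geometric]
    simpa [tsub_eq_zero_iff_le] using hx1
  have hZ : ∑' i : ℤ, x ^ i.natAbs ≠ ∞ := by
    have h1 : HasSum (fun n : ℕ => x ^ (n : ℤ).natAbs) (∑' n : ℕ, x ^ n) := by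
      simp only [Int.natAbs_natCast]
      exact ENNReal.summable.hasSum
    have h2 : HasSum (fun n : ℕ => x ^ (-((n : ℤ) + 1)).natAbs) (∑' n : ℕ, x ^ (n + 1)) := by
      have : ∀ n : ℕ, (-((n : ℤ) + 1)).natAbs = n + 1 := fun n => by omega
      simp only [this]
      exact ENNReal.summable.hasSum
    have h3 : ∑' i : ℤ, x ^ i.natAbs = _ :=
      (HasSum.of_nat_of_neg_add_one (f := fun i : ℤ => x ^ i.natAbs) h1 h2).tsum_eq
    rw [h3]
    refine ENNReal.add_ne_top.2 ⟨hs, ?_⟩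
    simp only [pow_succ]
    rw [ENNReal.tsum_mul_right]
    exact ENNReal.mul_ne_top hs (hx1.trans ENNReal.one_lt_top).ne
  refine ⟨2 ^ a * ∑' i : ℤ, x ^ i.natAbs,
    ENNReal.mul_ne_top (ENNReal.rpow_ne_top_of_nonneg ha.le (by norm_num)) hZ, fun s h0 h1 => ?_⟩
  obtain ⟨J, hJ1, hJ2⟩ := ENNReal.exists_mem_Ico_zpow h0 h1 (y := 2) (by norm_num) (by norm_num)
  rw [← ENNReal.tsum_mul_left]
  refine le_trans ?_ (ENNReal.tsum_comp_le_tsum_of_injective (f := fun j : ℕ => (j : ℤ) + J)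
    (fun i j h => by simpa using h) _)
  refine ENNReal.tsum_le_tsum fun j => ?_
  have e : ∀ l : ℤ, (2 : ℝ≥0∞) ^ ((j : ℤ) + l) = 2 ^ j * 2 ^ l := fun l => by
    rw [ENNReal.zpow_add (by norm_num) (by norm_num), zpow_natCast]
  have := two_zpow_mul_le (i := (j : ℤ) + J) (r := 2 ^ j * s) (by rw [e]; gcongr)
    (by rw [add_assoc, e]; gcongr)
  refine (ENNReal.rpow_le_rpow this ha.le).trans ?_
  rw [ENNReal.mul_rpow_of_nonneg _ _ ha.le, hx, ← ENNReal.rpow_natCast, ← ENNReal.rpow_mul,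
    ← ENNReal.rpow_natCast, ← ENNReal.rpow_mul, mul_comm a]

/-- After division by r^δ the left side decays like r^{k-δ} at 0 and r^{-δ} at infinity. A positive
a is available exactly because 0 < δ < k. -/
theorem min_pow_mul_le {a δ k : ℝ} (haδ : a ≤ δ) (hak : a ≤ k - δ)
    {r : ℝ≥0∞} (h0 : r ≠ 0) (h1 : r ≠ ∞) :
    min 1 (r ^ k) ≤ r ^ δ * dyadicWeight a r := by
  unfold dyadicWeight
  rcases le_total r 1 with h | h
  · rw [min_eq_left (h.trans (ENNReal.one_le_inv.2 h)), ← ENNReal.rpow_add _ _ h0 h1]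
    refine (min_le_right _ _).trans ?_
    exact ENNReal.rpow_le_rpow_of_exponent_ge h (by linarith)
  · rw [min_eq_right ((ENNReal.inv_le_one.2 h).trans h), ENNReal.inv_rpow, ← ENNReal.rpow_neg,
      ← ENNReal.rpow_add _ _ h0 h1]
    refine (min_le_left _ _).trans ?_
    rw [← ENNReal.rpow_zero (x := r)]
    exact ENNReal.rpow_le_rpow_of_exponent_le h (by linarith)

/-- In polar coordinates the radial density is y^{a-1} on (0, 1] and y^{-a-1} beyond. -/
theorem lintegral_dyadicWeight_ne_top {a : ℝ} (ha : 0 < a) (hd : 1 ≤ d) :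
    ∫⁻ h : Rd d, dyadicWeight a ‖h‖ₑ / ‖h‖ₑ ^ (d : ℝ) ≠ ∞ := by
  have : Nonempty (Fin d) := ⟨⟨0, hd⟩⟩
  set f : ℝ → ℝ := fun y => min y y⁻¹ ^ a / y ^ d with hf
  have hint : Integrable (fun h : Rd d => f ‖h‖) := by
    rw [integrable_fun_norm_addHaar]
    have h1 : IntegrableOn (fun y : ℝ => y ^ (a - 1)) (Set.Ioc 0 1) :=
      (intervalIntegrable_iff_integrableOn_Ioc_of_le zero_le_one).1
        (intervalIntegral.intervalIntegrable_rpow' (by linarith))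
    have h2 : IntegrableOn (fun y : ℝ => y ^ (-a - 1)) (Set.Ioi 1) :=
      integrableOn_Ioi_rpow_of_lt (by linarith) one_pos
    have e : ∀ y : ℝ, 0 < y →
        y ^ (Module.finrank ℝ (Rd d) - 1) • f y = min y y⁻¹ ^ a * y⁻¹ := fun y hy => by
      obtain ⟨l, rfl⟩ := Nat.exists_eq_add_of_le' hd
      simp only [finrank_euclideanSpace, Fintype.card_fin, Nat.add_sub_cancel, hf, smul_eq_mul]
      field_simp
      ring
    rw [← Set.Ioc_union_Ioi_eq_Ioi zero_le_one]
    refine IntegrableOn.union (h1.congr_fun (fun y hy => ?_) measurableSet_Ioc)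
      (h2.congr_fun (fun y hy => ?_) measurableSet_Ioi)
    · have hy0 : 0 < y := hy.1
      simp only [e y hy0]
      rw [min_eq_left (hy.2.trans ((one_le_inv₀ hy0).2 hy.2)), Real.rpow_sub_one hy0.ne',
        div_eq_mul_inv]
    · have hy1 : 1 < y := hy
      have hy0 : 0 < y := one_pos.trans hy1
      simp only [e y hy0]
      rw [min_eq_right ((inv_le_one_of_one_le₀ hy1.le).trans hy1.le), Real.rpow_sub_one hy0.ne',
        Real.inv_rpow hy0.le, Real.rpow_neg hy0.le, div_eq_mul_inv]
  have hle : ∫⁻ h : Rd d, dyadicWeight a ‖h‖ₑ / ‖h‖ₑ ^ (d : ℝ) = ∫⁻ h : Rd d, ‖f ‖h‖‖ₑ := by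
    refine lintegral_congr_ae ?_
    filter_upwards [Measure.ae_ne volume (0 : Rd d)] with h hh
    have hp : 0 < ‖h‖ := norm_pos_iff.2 hh
    have hm : 0 < min ‖h‖ ‖h‖⁻¹ := lt_min hp (inv_pos.2 hp)
    rw [hf, Real.enorm_of_nonneg (by positivity), ENNReal.ofReal_div_of_pos (by positivity),
      ENNReal.ofReal_pow hp.le, ofReal_norm, ← ENNReal.ofReal_rpow_of_pos hm, ENNReal.ofReal_min,
      ENNReal.ofReal_inv_of_pos hp, ofReal_norm, ENNReal.rpow_natCast, dyadicWeight]
  rw [hle]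
  exact hint.2.ne

/-- The measure dh/|h|^d is invariant under dilations. -/
theorem lintegral_dyadicWeight_mul (a : ℝ) (j : ℕ) :
    ∫⁻ h : Rd d, dyadicWeight a (2 ^ j * ‖h‖ₑ) / ‖h‖ₑ ^ (d : ℝ)
      = ∫⁻ h : Rd d, dyadicWeight a ‖h‖ₑ / ‖h‖ₑ ^ (d : ℝ) := by
  have h := lintegral_comp_smul (fun h : Rd d => dyadicWeight a ‖h‖ₑ / ‖h‖ₑ ^ (d : ℝ))
    (t := 2 ^ j) (by positivity)
  have e2 : ‖(2 : ℝ) ^ j‖ₑ = 2 ^ j := by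
    rw [enorm_pow, Real.enorm_of_nonneg (by norm_num)]
    simp
  have e3 : ENNReal.ofReal ((((2 : ℝ) ^ j) ^ d)⁻¹) = ((2 ^ j) ^ d)⁻¹ := by
    rw [ENNReal.ofReal_inv_of_pos (by positivity), ENNReal.ofReal_pow (by positivity),
      ENNReal.ofReal_pow (by positivity)]
    simp
  have h0 : ((2 : ℝ≥0∞) ^ j) ^ d ≠ 0 := by positivity
  have ht : ((2 : ℝ≥0∞) ^ j) ^ d ≠ ∞ := by simp
  simp only [enorm_smul, e2, e3, ENNReal.rpow_natCast, mul_pow] at h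
  have h' : ∀ x : Rd d, dyadicWeight a (2 ^ j * ‖x‖ₑ) / ‖x‖ₑ ^ (d : ℝ)
      = (2 ^ j) ^ d * (dyadicWeight a (2 ^ j * ‖x‖ₑ) / ((2 ^ j) ^ d * ‖x‖ₑ ^ d)) := fun x => by
    rw [ENNReal.rpow_natCast, div_eq_mul_inv, div_eq_mul_inv,
      ENNReal.mul_inv (Or.inl h0) (Or.inl ht), mul_left_comm _ ((_ : ℝ≥0∞)⁻¹),
      ← mul_assoc, ENNReal.mul_inv_cancel h0 ht, one_mul]
  simp only [h']
  rw [lintegral_const_mul' _ _ ht, h, ← mul_assoc, ENNReal.mul_inv_cancel h0 ht, one_mul]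
  simp only [ENNReal.rpow_natCast]

/-- Hölder's inequality for the weighted counting measure with weights w_j. -/
theorem tsum_mul_rpow_le {p : ℝ} (hp : 1 ≤ p) (w c : ℕ → ℝ≥0∞) :
    (∑' j, w j * c j) ^ p ≤ (∑' j, w j) ^ (p - 1) * ∑' j, w j * c j ^ p := by
  have hp0 : 0 < p := by linarith
  have h1 : ∑' j, w j * c j ≤ (∑' j, w j) ^ (1 - p⁻¹) * (∑' j, w j * c j ^ p) ^ p⁻¹ := by
    rw [ENNReal.tsum_eq_iSup_sum]
    refine iSup_le fun s => (ENNReal.inner_le_weight_mul_Lp_of_nonneg s hp w c).trans ?_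
    have h2 : 0 ≤ 1 - p⁻¹ := by
      have := inv_le_one_of_one_le₀ hp
      linarith
    gcongr
    · exact ENNReal.sum_le_tsum s
    · exact ENNReal.sum_le_tsum s
  refine (ENNReal.rpow_le_rpow h1 hp0.le).trans (le_of_eq ?_)
  rw [ENNReal.mul_rpow_of_nonneg _ _ hp0.le, ← ENNReal.rpow_mul, ← ENNReal.rpow_mul,
    inv_mul_cancel₀ hp0.ne', ENNReal.rpow_one, sub_mul, one_mul, inv_mul_cancel₀ hp0.ne']

theorem lintegral_rpow_le_measure {α : Type*} [MeasurableSpace α] (μ : Measure α) {p : ℝ}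
    (hp : 1 < p) {w : α → ℝ≥0∞} (hw : Measurable w) :
    (∫⁻ x, w x ∂μ) ^ p ≤ μ Set.univ ^ (p - 1) * ∫⁻ x, w x ^ p ∂μ := by
  have hp0 : 0 < p := by linarith
  have hpq := Real.HolderConjugate.conjExponent hp
  have := ENNReal.lintegral_mul_le_Lp_mul_Lq μ hpq hw.aemeasurable
    (g := fun _ => 1) aemeasurable_const
  simp only [Pi.mul_apply, mul_one, ENNReal.one_rpow, lintegral_const, one_mul] at this
  refine (ENNReal.rpow_le_rpow this hp0.le).trans (le_of_eq ?_)
  rw [ENNReal.mul_rpow_of_nonneg _ _ hp0.le, ← ENNReal.rpow_mul, ← ENNReal.rpow_mul,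
    one_div_mul_cancel hp0.ne', ENNReal.rpow_one, mul_comm]
  congr 2
  rw [Real.conjExponent]
  field_simp

/-- The scaled averages `2^{jγ} · 2^{jd} ∫_{|h| < 2^{-j}} w(h) dh`. -/
noncomputable def dyadicAvg (γ : ℝ) (w : Rd d → ℝ≥0∞) (j : ℕ) : ℝ≥0∞ :=
  ((2 : ℝ≥0∞) ^ j) ^ γ * ballAvg w (((2 : ℝ) ^ j)⁻¹)

theorem two_pow_ne_zero' (j : ℕ) : (2 : ℝ≥0∞) ^ j ≠ 0 := by positivity

theorem two_pow_ne_top (j : ℕ) : (2 : ℝ≥0∞) ^ j ≠ ∞ := by simp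

/-- Hölder on the ball brings the power p inside the average. After exchanging sum and integral, a
given h only meets the scales with 2^j |h| < 1, over which the weights (2^j |h|)^{d+pγ} are
summable. -/
theorem exists_tsum_dyadicAvg_rpow_le (hd : 1 ≤ d) {γ p : ℝ} (hγ : 0 < γ) (hp : 1 < p) :
    ∃ C : ℝ≥0∞, C ≠ ∞ ∧ ∀ w : Rd d → ℝ≥0∞, Measurable w →
      ∑' j, dyadicAvg γ w j ^ p ≤ C * ∫⁻ h, w h ^ p / ‖h‖ₑ ^ ((d : ℝ) + p * γ) := by
  have : Nonempty (Fin d) := ⟨⟨0, hd⟩⟩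
  have hp0 : 0 < p := by linarith
  set a : ℝ := (d : ℝ) + p * γ with ha
  have ha0 : 0 < a := by positivity
  obtain ⟨C, hC, hsum⟩ := exists_tsum_dyadicWeight_le ha0
  set V : ℝ≥0∞ := volume (Metric.ball (0 : Rd d) 1) ^ (p - 1) with hV
  have hVt : V ≠ ∞ := ENNReal.rpow_ne_top_of_nonneg (by linarith) measure_ball_lt_top.ne
  refine ⟨V * C, ENNReal.mul_ne_top hVt hC, fun w hw => ?_⟩
  have h1 : ∀ j, dyadicAvg γ w j ^ p ≤ V * ∫⁻ h,
      dyadicWeight a (2 ^ j * ‖h‖ₑ) * (w h ^ p / ‖h‖ₑ ^ a) := by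
    intro j
    have ht : 0 < ((2 : ℝ) ^ j)⁻¹ := by positivity
    have e3 : ENNReal.ofReal (((((2 : ℝ) ^ j)⁻¹) ^ d)⁻¹) = (2 ^ j) ^ (d : ℝ) := by
      rw [inv_pow, inv_inv, ENNReal.ofReal_pow (by positivity), ENNReal.ofReal_pow (by positivity)]
      simp
    rw [dyadicAvg, ENNReal.mul_rpow_of_nonneg _ _ hp0.le, ← setLIntegral_ball_comp_smul w ht]
    have h2 := lintegral_rpow_le_measure (volume.restrict (Metric.ball (0 : Rd d) 1)) hp
      (w := fun y => w (((2 : ℝ) ^ j)⁻¹ • y)) (hw.comp (by fun_prop))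
    rw [Measure.restrict_apply_univ, setLIntegral_ball_comp_smul (fun h => w h ^ p) ht, ballAvg,
      e3] at h2
    refine (mul_le_mul_right h2 _).trans ?_
    rw [mul_left_comm]
    refine mul_le_mul_right ?_ _
    rw [← mul_assoc, ← ENNReal.rpow_mul, ← ENNReal.rpow_add _ _ (two_pow_ne_zero' j)
      (two_pow_ne_top j), ← lintegral_const_mul' _ _ (ENNReal.rpow_ne_top_of_nonneg
        (by positivity) (two_pow_ne_top j)), ← lintegral_indicator Metric.isOpen_ball.measurableSet]
    refine lintegral_mono_ae ?_
    filter_upwards [Measure.ae_ne volume (0 : Rd d)] with h h0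
    by_cases hb : h ∈ Metric.ball (0 : Rd d) (((2 : ℝ) ^ j)⁻¹)
    · rw [Set.indicator_of_mem hb]
      -- On the ball the minimum defining `dyadicWeight` is its first argument.
      have hlt : 2 ^ j * ‖h‖ₑ ≤ 1 := by
        rw [mem_ball_zero_iff] at hb
        rw [← ofReal_norm, show (2 : ℝ≥0∞) ^ j = ENNReal.ofReal (2 ^ j) by
          rw [ENNReal.ofReal_pow (by norm_num)]; simp, ← ENNReal.ofReal_mul (by positivity)]
        refine ENNReal.ofReal_le_one.2 ?_
        calc (2 : ℝ) ^ j * ‖h‖ ≤ 2 ^ j * ((2 : ℝ) ^ j)⁻¹ := by gcongr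
          _ = 1 := mul_inv_cancel₀ (by positivity)
      rw [dyadicWeight, min_eq_left (hlt.trans (ENNReal.one_le_inv.2 hlt)),
        ENNReal.mul_rpow_of_nonneg _ _ ha0.le, mul_assoc, ENNReal.mul_div_cancel
          (by simp [h0]) (ENNReal.rpow_ne_top_of_nonneg ha0.le enorm_ne_top), ha]
      refine le_of_eq ?_
      congr 2
      ring
    · rw [Set.indicator_of_notMem hb]
      exact zero_le
  calc ∑' j, dyadicAvg γ w j ^ p
      ≤ ∑' j : ℕ, V * ∫⁻ h, dyadicWeight a (2 ^ j * ‖h‖ₑ) * (w h ^ p / ‖h‖ₑ ^ a) :=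
        ENNReal.tsum_le_tsum h1
    _ = V * ∫⁻ h, ∑' j : ℕ, dyadicWeight a (2 ^ j * ‖h‖ₑ) * (w h ^ p / ‖h‖ₑ ^ a) := by
        rw [ENNReal.tsum_mul_left, lintegral_tsum]
        intro j
        have := measurable_dyadicWeight a
        fun_prop
    _ ≤ V * ∫⁻ h, C * (w h ^ p / ‖h‖ₑ ^ a) := by
        refine mul_le_mul_right (lintegral_mono_ae ?_) _
        filter_upwards [Measure.ae_ne volume (0 : Rd d)] with h h0
        rw [ENNReal.tsum_mul_right]
        gcongr
        exact hsum _ (by simpa using h0) enorm_ne_top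
    _ = V * C * ∫⁻ h, w h ^ p / ‖h‖ₑ ^ a := by
        rw [lintegral_const_mul' _ _ hC, mul_assoc]

theorem dyadicAvg_le {γ : ℝ} (hγ : 0 < γ) {w : Rd d → ℝ≥0∞} {S : ℝ≥0∞}
    (hw : ∀ h, w h ≤ S * ‖h‖ₑ ^ γ) (j : ℕ) :
    dyadicAvg γ w j ≤ volume (Metric.ball (0 : Rd d) 1) * S := by
  have ht : 0 < ((2 : ℝ) ^ j)⁻¹ := by positivity
  have h1 : ballAvg w (((2 : ℝ) ^ j)⁻¹)
      ≤ ∫⁻ _y in Metric.ball (0 : Rd d) 1, S * (((2 : ℝ≥0∞) ^ j)⁻¹) ^ γ := by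
    rw [← setLIntegral_ball_comp_smul w ht]
    refine setLIntegral_mono' Metric.isOpen_ball.measurableSet fun y hy => (hw _).trans ?_
    gcongr
    rw [enorm_smul]
    have e1 : ‖((2 : ℝ) ^ j)⁻¹‖ₑ = ((2 : ℝ≥0∞) ^ j)⁻¹ := by
      rw [Real.enorm_of_nonneg ht.le, ENNReal.ofReal_inv_of_pos (by positivity),
        ENNReal.ofReal_pow (by norm_num)]
      simp
    rw [e1]
    refine mul_le_of_le_one_right zero_le ?_
    rw [← ofReal_norm, ENNReal.ofReal_le_one]
    exact (mem_ball_zero_iff.1 hy).le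
  rw [setLIntegral_const] at h1
  calc dyadicAvg γ w j ≤ ((2 : ℝ≥0∞) ^ j) ^ γ *
        (S * (((2 : ℝ≥0∞) ^ j)⁻¹) ^ γ * volume (Metric.ball (0 : Rd d) 1)) :=
        mul_le_mul_right h1 _
    _ = (((2 : ℝ≥0∞) ^ j) ^ γ * (((2 : ℝ≥0∞) ^ j)⁻¹) ^ γ) *
        (volume (Metric.ball (0 : Rd d) 1) * S) := by ring
    _ = volume (Metric.ball (0 : Rd d) 1) * S := by
        rw [← ENNReal.mul_rpow_of_nonneg _ _ hγ.le, ENNReal.mul_inv_cancel (two_pow_ne_zero' j)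
          (two_pow_ne_top j), ENNReal.one_rpow, one_mul]

/-- The majorant of the differences of a dyadic series whose `j`-th term has size
`2^{-jδ} c_j`. -/
noncomputable def dyadicMajorant (k : ℕ) (δ : ℝ) (c : ℕ → ℝ≥0∞) (r : ℝ≥0∞) : ℝ≥0∞ :=
  ∑' j : ℕ, min 1 ((2 ^ j * r) ^ k) * (((2 : ℝ≥0∞) ^ j) ^ (-δ) * c j)

theorem dyadicMajorant_le {k : ℕ} {δ : ℝ} (hδ : 0 < δ) (c : ℕ → ℝ≥0∞)
    {r : ℝ≥0∞} (h0 : r ≠ 0) (h1 : r ≠ ∞) :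
    dyadicMajorant k δ c r
      ≤ r ^ δ * ∑' j : ℕ, dyadicWeight (min δ (k - δ)) (2 ^ j * r) * c j := by
  rw [dyadicMajorant, ← ENNReal.tsum_mul_left]
  refine ENNReal.tsum_le_tsum fun j => ?_
  have h2 := min_pow_mul_le (min_le_left δ (k - δ)) (min_le_right δ (k - δ))
    (mul_ne_zero (two_pow_ne_zero' j) h0) (ENNReal.mul_ne_top (two_pow_ne_top j) h1)
  rw [ENNReal.rpow_natCast, ENNReal.mul_rpow_of_nonneg _ _ hδ.le] at h2
  calc min 1 ((2 ^ j * r) ^ k) * (((2 : ℝ≥0∞) ^ j) ^ (-δ) * c j)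
      ≤ (2 ^ j) ^ δ * r ^ δ * dyadicWeight (min δ (k - δ)) (2 ^ j * r)
        * (((2 : ℝ≥0∞) ^ j) ^ (-δ) * c j) := mul_le_mul_left h2 _
    _ = (((2 : ℝ≥0∞) ^ j) ^ δ * ((2 : ℝ≥0∞) ^ j) ^ (-δ)) *
        (r ^ δ * (dyadicWeight (min δ (k - δ)) (2 ^ j * r) * c j)) := by ring
    _ = r ^ δ * (dyadicWeight (min δ (k - δ)) (2 ^ j * r) * c j) := by
        rw [← ENNReal.rpow_add _ _ (two_pow_ne_zero' j) (two_pow_ne_top j), add_neg_cancel,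
          ENNReal.rpow_zero, one_mul]

theorem exists_dyadicMajorant_le {k : ℕ} {δ : ℝ} (hδ : 0 < δ) (hδk : δ < k) :
    ∃ C : ℝ≥0∞, C ≠ ∞ ∧ ∀ (c : ℕ → ℝ≥0∞) (r : ℝ≥0∞), r ≠ 0 → r ≠ ∞ →
      dyadicMajorant k δ c r ≤ C * (⨆ j, c j) * r ^ δ := by
  obtain ⟨C, hC, hsum⟩ := exists_tsum_dyadicWeight_le (lt_min hδ (sub_pos.2 hδk))
  refine ⟨C, hC, fun c r h0 h1 => (dyadicMajorant_le hδ c h0 h1).trans ?_⟩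
  rw [mul_comm]
  gcongr
  calc ∑' j : ℕ, dyadicWeight (min δ (k - δ)) (2 ^ j * r) * c j
      ≤ ∑' j : ℕ, dyadicWeight (min δ (k - δ)) (2 ^ j * r) * ⨆ j, c j :=
        ENNReal.tsum_le_tsum fun j => mul_le_mul_right (le_iSup c j) _
    _ ≤ C * ⨆ j, c j := by
        rw [ENNReal.tsum_mul_right]
        gcongr
        exact hsum r h0 h1

/-- A Schur test: the weights have sums over j bounded uniformly in h, and integrals against
dh/|h|^d independent of j. Hölder in j with these weights, followed by exchanging sum and integral,
gives the bound. -/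
theorem exists_lintegral_dyadicMajorant_le (hd : 1 ≤ d) {k : ℕ} {δ p : ℝ} (hδ : 0 < δ)
    (hδk : δ < k) (hp : 1 < p) :
    ∃ C : ℝ≥0∞, C ≠ ∞ ∧ ∀ c : ℕ → ℝ≥0∞,
      ∫⁻ h : Rd d, dyadicMajorant k δ c ‖h‖ₑ ^ p / ‖h‖ₑ ^ ((d : ℝ) + p * δ)
        ≤ C * ∑' j, c j ^ p := by
  have : Nonempty (Fin d) := ⟨⟨0, hd⟩⟩
  have hp0 : 0 < p := by linarith
  have ha : 0 < min δ (k - δ) := lt_min hδ (sub_pos.2 hδk)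
  obtain ⟨C, hC, hsum⟩ := exists_tsum_dyadicWeight_le ha
  have hI := lintegral_dyadicWeight_ne_top ha hd
  set I := ∫⁻ h : Rd d, dyadicWeight (min δ (k - δ)) ‖h‖ₑ / ‖h‖ₑ ^ (d : ℝ) with hIdef
  have hCp : C ^ (p - 1) ≠ ∞ := ENNReal.rpow_ne_top_of_nonneg (by linarith) hC
  refine ⟨C ^ (p - 1) * I, ENNReal.mul_ne_top hCp hI, fun c => ?_⟩
  have hm := measurable_dyadicWeight (min δ (k - δ))
  have h1 : ∀ h : Rd d, h ≠ 0 →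
      dyadicMajorant k δ c ‖h‖ₑ ^ p / ‖h‖ₑ ^ ((d : ℝ) + p * δ)
        ≤ C ^ (p - 1) * ∑' j : ℕ,
          dyadicWeight (min δ (k - δ)) (2 ^ j * ‖h‖ₑ) / ‖h‖ₑ ^ (d : ℝ) * c j ^ p := by
    intro h hh
    have h0 : ‖h‖ₑ ≠ 0 := by simpa using hh
    have ht : ‖h‖ₑ ≠ ∞ := enorm_ne_top
    set r := ‖h‖ₑ with hr
    set W : ℝ≥0∞ := ∑' j : ℕ, dyadicWeight (min δ (k - δ)) (2 ^ j * r) * c j ^ p with hW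
    have h2 : dyadicMajorant k δ c r ^ p ≤ r ^ (p * δ) * (C ^ (p - 1) * W) := by
      refine (ENNReal.rpow_le_rpow (dyadicMajorant_le hδ c h0 ht) hp0.le).trans ?_
      rw [ENNReal.mul_rpow_of_nonneg _ _ hp0.le, ← ENNReal.rpow_mul, mul_comm δ p]
      refine mul_le_mul_right ((tsum_mul_rpow_le hp.le _ _).trans ?_) _
      refine mul_le_mul_left (ENNReal.rpow_le_rpow (hsum r h0 ht) (by linarith)) _
    refine (ENNReal.div_le_div_right h2 _).trans (le_of_eq ?_)
    have e1 : r ^ (p * δ) / r ^ ((d : ℝ) + p * δ) = (r ^ (d : ℝ))⁻¹ := by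
      rw [← ENNReal.rpow_sub _ _ h0 ht, ← ENNReal.rpow_neg]
      congr 1
      ring
    simp only [div_eq_mul_inv, mul_right_comm _ ((r ^ (d : ℝ))⁻¹)] at e1 ⊢
    rw [ENNReal.tsum_mul_right, mul_right_comm, e1, hW]
    ring
  calc ∫⁻ h : Rd d, dyadicMajorant k δ c ‖h‖ₑ ^ p / ‖h‖ₑ ^ ((d : ℝ) + p * δ)
      ≤ ∫⁻ h : Rd d, C ^ (p - 1) * ∑' j : ℕ,
          dyadicWeight (min δ (k - δ)) (2 ^ j * ‖h‖ₑ) / ‖h‖ₑ ^ (d : ℝ) * c j ^ p := by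
        refine lintegral_mono_ae ?_
        filter_upwards [Measure.ae_ne volume (0 : Rd d)] with h hh using h1 h hh
    _ = C ^ (p - 1) * ∑' j : ℕ, ∫⁻ h : Rd d,
          dyadicWeight (min δ (k - δ)) (2 ^ j * ‖h‖ₑ) / ‖h‖ₑ ^ (d : ℝ) * c j ^ p := by
        rw [lintegral_const_mul' _ _ hCp, lintegral_tsum]
        intro j
        fun_prop
    _ = C ^ (p - 1) * I * ∑' j, c j ^ p := by
        have : ∀ j : ℕ, ∫⁻ h : Rd d, dyadicWeight (min δ (k - δ)) (2 ^ j * ‖h‖ₑ)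
            / ‖h‖ₑ ^ (d : ℝ) * c j ^ p = I * c j ^ p := by
          intro j
          rw [lintegral_mul_const _ (by fun_prop), lintegral_dyadicWeight_mul]
        simp only [this]
        rw [ENNReal.tsum_mul_left, mul_assoc]

end HolderZygmund

namespace HolderZygmund

variable {d : ℕ}

/-! ### Sequence norms -/

open Classical in
/-- The `ℓ_p` norm of a sequence in `[0, ∞]`. -/
noncomputable def seqNorm (p : ℝ≥0∞) (c : ℕ → ℝ≥0∞) : ℝ≥0∞ :=
  if p = ∞ then ⨆ j, c j else (∑' j, c j ^ p.toReal) ^ (1 / p.toReal)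

theorem one_lt_toReal {p : ℝ≥0∞} (hp : 1 < p) (hpt : p ≠ ∞) : 1 < p.toReal := by
  have := (ENNReal.toReal_lt_toReal ENNReal.one_ne_top hpt).2 hp
  simpa using this

theorem le_seqNorm {p : ℝ≥0∞} (hp : 1 < p) (c : ℕ → ℝ≥0∞) (j : ℕ) : c j ≤ seqNorm p c := by
  unfold seqNorm
  split_ifs with h
  · exact le_iSup c j
  · have h0 : 0 < p.toReal := one_pos.trans (one_lt_toReal hp h)
    rw [one_div, ENNReal.le_rpow_inv_iff h0]
    exact ENNReal.le_tsum (f := fun j => c j ^ p.toReal) j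

/-- Used to absorb the coarsest approximation, of size ‖f‖_∞, into the coefficient j = 0. The crude
constant 2 avoids Minkowski's inequality. -/
theorem seqNorm_add_single_le {p : ℝ≥0∞} (hp : 1 < p) (c : ℕ → ℝ≥0∞) (M : ℝ≥0∞) :
    seqNorm p (fun j => c j + if j = 0 then M else 0) ≤ 2 * (seqNorm p c + M) := by
  unfold seqNorm
  split_ifs with h
  · refine iSup_le fun j => ?_
    refine le_trans ?_ (le_mul_of_one_le_left zero_le (by norm_num))
    refine add_le_add (le_iSup c j) ?_
    split_ifs <;> simp
  · have h1 := one_lt_toReal hp h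
    set q := p.toReal
    have h0 : 0 < q := one_pos.trans h1
    have e : ∑' j : ℕ, (if j = 0 then M else 0) ^ q = M ^ q := by
      rw [tsum_eq_single 0]
      · simp
      · intro j hj
        simp [hj, h0]
    have h2 : ∑' j : ℕ, (c j + if j = 0 then M else 0) ^ q
        ≤ 2 ^ (q - 1) * (∑' j, c j ^ q + M ^ q) := by
      rw [← e, ← ENNReal.tsum_add, ← ENNReal.tsum_mul_left]
      exact ENNReal.tsum_le_tsum fun j => ENNReal.rpow_add_le_mul_rpow_add_rpow _ _ h1.le
    have hq : 0 ≤ 1 / q := by positivity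
    refine (ENNReal.rpow_le_rpow h2 hq).trans ?_
    rw [ENNReal.mul_rpow_of_nonneg _ _ hq]
    refine mul_le_mul' ?_ ?_
    · rw [← ENNReal.rpow_mul]
      refine (ENNReal.rpow_le_rpow_of_exponent_le (by norm_num) ?_).trans_eq (ENNReal.rpow_one 2)
      rw [mul_one_div, div_le_one h0]
      linarith
    · refine (ENNReal.rpow_add_le_add_rpow _ _ hq ?_).trans ?_
      · rw [div_le_one h0]
        exact h1.le
      · rw [← ENNReal.rpow_mul, mul_one_div_cancel h0.ne', ENNReal.rpow_one]

theorem diffNorm_zero {𝕜 : Type*} [RCLike 𝕜] (γ : ℝ) (f : Rd d → 𝕜) : diffNorm γ f 0 = 0 := by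
  rw [diffNorm, diffOrder, Function.iterate_succ_apply']
  have : fwdDiff (0 : Rd d) ((fwdDiff (0 : Rd d))^[⌊γ⌋₊] f) = fun _ => 0 := by
    funext x
    simp [fwdDiff]
  rw [this]
  exact eLpNorm_zero

theorem exists_seqNorm_dyadicAvg_le (hd : 1 ≤ d) {γ : ℝ} (hγ : 0 < γ) {p : ℝ≥0∞} (hp : 1 < p) :
    ∃ C : ℝ≥0∞, C ≠ ∞ ∧ ∀ (𝕜 : Type) [RCLike 𝕜] (f : Rd d → 𝕜), AEStronglyMeasurable f volume →
      seqNorm p (dyadicAvg γ (diffNorm γ f)) ≤ C * zygmundSeminorm γ p f := by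
  by_cases h : p = ∞
  · subst h
    refine ⟨volume (Metric.ball (0 : Rd d) 1), measure_ball_lt_top.ne, fun 𝕜 _ f hf => ?_⟩
    simp only [seqNorm, zygmundSeminorm, if_true]
    refine iSup_le fun j => dyadicAvg_le hγ (fun h => ?_) j
    by_cases h0 : h = 0
    · subst h0
      rw [diffNorm_zero]
      exact zero_le
    · have h1 : ‖h‖ₑ ≠ 0 := by simpa using h0
      rw [← ENNReal.div_le_iff (by simp [h0])
        (ENNReal.rpow_ne_top_of_nonneg hγ.le enorm_ne_top)]
      exact le_iSup (fun h : Rd d => diffNorm γ f h / ‖h‖ₑ ^ γ) h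
  · have h1 := one_lt_toReal hp h
    set q := p.toReal with hq
    have hq0 : 0 ≤ 1 / q := by positivity
    obtain ⟨C, hC, hle⟩ := exists_tsum_dyadicAvg_rpow_le hd hγ h1
    refine ⟨C ^ (1 / q), ENNReal.rpow_ne_top_of_nonneg hq0 hC, fun 𝕜 _ f hf => ?_⟩
    simp only [seqNorm, zygmundSeminorm, if_neg h]
    rw [← hq, ← ENNReal.mul_rpow_of_nonneg _ _ hq0]
    exact ENNReal.rpow_le_rpow (hle _ (measurable_diffNorm hf γ)) hq0

theorem exists_zygmundSeminorm_le_seqNorm (hd : 1 ≤ d) {k : ℕ} {δ : ℝ} (hδ : 0 < δ) (hδk : δ < k)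
    {p : ℝ≥0∞} (hp : 1 < p) :
    ∃ C : ℝ≥0∞, C ≠ ∞ ∧ ∀ (𝕜 : Type) [RCLike 𝕜] (g : Rd d → 𝕜) (A : ℝ≥0∞) (c : ℕ → ℝ≥0∞),
      A ≠ ∞ → (∀ h, diffNorm δ g h ≤ A * dyadicMajorant k δ c ‖h‖ₑ) →
        zygmundSeminorm δ p g ≤ C * (A * seqNorm p c) := by
  by_cases h : p = ∞
  · subst h
    obtain ⟨C, hC, hle⟩ := exists_dyadicMajorant_le hδ hδk
    refine ⟨C, hC, fun 𝕜 _ g A c hA hg => ?_⟩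
    simp only [seqNorm, zygmundSeminorm, if_true]
    refine iSup_le fun h => ?_
    by_cases h0 : h = 0
    · subst h0
      rw [diffNorm_zero, ENNReal.zero_div]
      exact zero_le
    · have h1 : ‖h‖ₑ ≠ 0 := by simpa using h0
      rw [ENNReal.div_le_iff (by simp [h0])
        (ENNReal.rpow_ne_top_of_nonneg hδ.le enorm_ne_top)]
      refine (hg h).trans ((mul_le_mul_right (hle c _ h1 enorm_ne_top) A).trans_eq ?_)
      ring
  · have h1 := one_lt_toReal hp h
    set q := p.toReal with hq
    have h0 : 0 < q := one_pos.trans h1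
    have hq0 : 0 ≤ 1 / q := by positivity
    obtain ⟨C, hC, hle⟩ := exists_lintegral_dyadicMajorant_le hd hδ hδk h1
    refine ⟨C ^ (1 / q), ENNReal.rpow_ne_top_of_nonneg hq0 hC, fun 𝕜 _ g A c hA hg => ?_⟩
    simp only [seqNorm, zygmundSeminorm, if_neg h]
    rw [← hq]
    have h2 : ∫⁻ h : Rd d, diffNorm δ g h ^ q / ‖h‖ₑ ^ ((d : ℝ) + q * δ)
        ≤ C * (A ^ q * ∑' j, c j ^ q) := by
      calc ∫⁻ h : Rd d, diffNorm δ g h ^ q / ‖h‖ₑ ^ ((d : ℝ) + q * δ)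
          ≤ ∫⁻ h : Rd d, A ^ q *
            (dyadicMajorant k δ c ‖h‖ₑ ^ q / ‖h‖ₑ ^ ((d : ℝ) + q * δ)) := by
            refine lintegral_mono fun h => ?_
            rw [← mul_div_assoc, ← ENNReal.mul_rpow_of_nonneg _ _ h0.le]
            exact ENNReal.div_le_div_right (ENNReal.rpow_le_rpow (hg h) h0.le) _
        _ ≤ C * (A ^ q * ∑' j, c j ^ q) := by
            rw [lintegral_const_mul' _ _ (ENNReal.rpow_ne_top_of_nonneg h0.le hA), mul_left_comm]
            exact mul_le_mul_right (hle c) _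
    refine (ENNReal.rpow_le_rpow h2 hq0).trans_eq ?_
    rw [ENNReal.mul_rpow_of_nonneg _ _ hq0, ENNReal.mul_rpow_of_nonneg _ _ hq0,
      ← ENNReal.rpow_mul A, mul_one_div_cancel h0.ne', ENNReal.rpow_one]

/-! ### Uniformly convergent series -/

variable {𝕜 : Type*} [RCLike 𝕜]

theorem summable_of_enorm_le {G : ℕ → 𝕜} {a : ℕ → ℝ≥0∞} (h : ∀ j, ‖G j‖ₑ ≤ a j)
    (ha : ∑' j, a j ≠ ∞) : Summable G := by
  refine Summable.of_nnnorm (ENNReal.tsum_coe_ne_top_iff_summable.1 (ne_top_of_le_ne_top ha ?_))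
  exact ENNReal.tsum_le_tsum h

theorem fwdDiff_iterate_tsum {G : ℕ → Rd d → 𝕜} (hG : ∀ x, Summable fun j => G j x) (h : Rd d)
    (k : ℕ) (x : Rd d) :
    (Summable fun j => (fwdDiff h)^[k] (G j) x) ∧
      (fwdDiff h)^[k] (fun x => ∑' j, G j x) x = ∑' j, (fwdDiff h)^[k] (G j) x := by
  induction k generalizing x with
  | zero => exact ⟨hG x, rfl⟩
  | succ k ih =>
    simp only [Function.iterate_succ_apply']
    refine ⟨(ih (x + h)).1.sub (ih x).1, ?_⟩
    simp only [fwdDiff]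
    rw [(ih (x + h)).2, (ih x).2, (ih (x + h)).1.tsum_sub (ih x).1]

theorem isBdd_tsum {G : ℕ → Rd d → 𝕜} (hm : ∀ j, StronglyMeasurable (G j)) {a : ℕ → ℝ≥0∞}
    (h : ∀ j x, ‖G j x‖ₑ ≤ a j) (ha : ∑' j, a j ≠ ∞) : IsBdd (fun x => ∑' j, G j x) := by
  refine ⟨?_, (∑' j, a j).toReal, fun x => ?_⟩
  · refine stronglyMeasurable_of_tendsto Filter.atTop
      (f := fun J x => ∑ j ∈ Finset.range J, G j x)
      (fun J => Finset.stronglyMeasurable_fun_sum _ fun j _ => hm j) ?_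
    rw [tendsto_pi_nhds]
    exact fun x => (summable_of_enorm_le (fun j => h j x) ha).hasSum.tendsto_sum_nat
  · have h1 : ‖∑' j, G j x‖ₑ ≤ ∑' j, a j :=
      enorm_tsum_le_tsum_enorm.trans (ENNReal.tsum_le_tsum fun j => h j x)
    rw [← ofReal_norm] at h1
    exact (ENNReal.ofReal_le_iff_le_toReal ha).1 h1

/-- The error is minus the tail of the series, dominated pointwise by the tail of the sum of the
a_j. -/
theorem tendsto_eLpNorm_partialSum_sub {G : ℕ → Rd d → 𝕜} {a : ℕ → ℝ≥0∞}
    (h : ∀ j x, ‖G j x‖ₑ ≤ a j) (ha : ∑' j, a j ≠ ∞) (v : Rd d → 𝕜) :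
    Filter.Tendsto (fun J => eLpNorm (fun x => (v x + ∑ j ∈ Finset.range J, G j x)
      - (v x + ∑' j, G j x)) ∞ volume) Filter.atTop (nhds 0) := by
  refine tendsto_of_tendsto_of_tendsto_of_le_of_le tendsto_const_nhds
    (ENNReal.tendsto_sum_nat_add a ha) (fun _ => zero_le) fun J => ?_
  refine eLpNorm_top_le (Filter.Eventually.of_forall fun x => ?_)
  have hs := summable_of_enorm_le (fun j => h j x) ha
  have : (v x + ∑ j ∈ Finset.range J, G j x) - (v x + ∑' j, G j x) = - ∑' j, G (j + J) x := by
    rw [← hs.sum_add_tsum_nat_add J]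
    ring
  rw [this, enorm_neg]
  exact enorm_tsum_le_tsum_enorm.trans (ENNReal.tsum_le_tsum fun j => h _ x)

end HolderZygmund

namespace HolderZygmund

variable {d : ℕ} {𝕜 : Type*} [RCLike 𝕜]

/-! ### Derivatives of the smooth approximations -/

/-- The scaled correlation representing a derivative of order `l` of `corr ψ (2^{-i}) e`. -/
noncomputable def dyadicCorr (ψ : Rd d → ℝ) (l i : ℕ) (e : Rd d → 𝕜) (x : Rd d) : 𝕜 :=
  (-(((2 : ℝ) ^ i)⁻¹)⁻¹) ^ l • corr ψ (((2 : ℝ) ^ i)⁻¹) e x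

theorem enorm_two_pow (i : ℕ) : ‖(2 : ℝ) ^ i‖ₑ = 2 ^ i := by
  rw [enorm_pow, Real.enorm_of_nonneg (by norm_num)]
  simp

theorem inv_two_pow_ne_zero (i : ℕ) : ((2 : ℝ) ^ i)⁻¹ ≠ 0 := by positivity

theorem IsBdd.dyadicCorr {e : Rd d → 𝕜} (he : IsBdd e) {ψ : Rd d → ℝ} (hψ : IsTest ψ) (l i : ℕ) :
    IsBdd (dyadicCorr ψ l i e) := (he.corr hψ _).const_smul _

theorem enorm_dyadicCorr_le {ψ : Rd d → ℝ} (hψ : IsTest ψ) (l i : ℕ) (e : Rd d → 𝕜) (x : Rd d) :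
    ‖dyadicCorr ψ l i e x‖ₑ ≤ (2 ^ i) ^ l * ((∫⁻ y, ‖ψ y‖ₑ) * eLpNorm e ∞ volume) := by
  rw [dyadicCorr, enorm_smul, enorm_pow, enorm_neg, inv_inv, enorm_two_pow]
  gcongr
  exact enorm_corr_le (inv_two_pow_ne_zero i) hψ e x

theorem fwdDiff_iterate_dyadicCorr {ψ : Rd d → ℝ} (hψ : IsTest ψ) (l i : ℕ) {e : Rd d → 𝕜}
    (he : IsBdd e) (h : Rd d) (k : ℕ) :
    (fwdDiff h)^[k] (dyadicCorr ψ l i e)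
      = dyadicCorr ((fwdDiff (-((2 : ℝ) ^ i • h)))^[k] ψ) l i e := by
  have h1 : dyadicCorr ψ l i e
      = (-(((2 : ℝ) ^ i)⁻¹)⁻¹) ^ l • corr ψ (((2 : ℝ) ^ i)⁻¹) e := rfl
  rw [h1, fwdDiff_iter_const_smul, fwdDiff_iterate_corr hψ (inv_two_pow_ne_zero i) he, inv_inv]
  funext x
  rw [dyadicCorr, inv_inv]
  rfl

theorem enorm_fwdDiff_dyadicCorr_le {ψ : Rd d → ℝ} (hψ : IsTest ψ) {k : ℕ} {C : ℝ≥0∞}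
    (hC : ∀ h, ∫⁻ x, ‖(fwdDiff h)^[k] ψ x‖ₑ ≤ C * min 1 (‖h‖ₑ ^ k)) (l i : ℕ) {e : Rd d → 𝕜}
    (he : IsBdd e) (h x : Rd d) :
    ‖(fwdDiff h)^[k] (dyadicCorr ψ l i e) x‖ₑ
      ≤ (2 ^ i) ^ l * (C * min 1 ((2 ^ i * ‖h‖ₑ) ^ k) * eLpNorm e ∞ volume) := by
  rw [fwdDiff_iterate_dyadicCorr hψ l i he]
  refine (enorm_dyadicCorr_le (hψ.fwdDiff_iterate _ _) l i e x).trans ?_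
  gcongr
  refine (hC _).trans_eq ?_
  rw [enorm_neg, enorm_smul, enorm_two_pow]

theorem min_two_mul_pow_le (k : ℕ) (r : ℝ≥0∞) :
    min 1 ((2 * r) ^ k) ≤ 2 ^ k * min 1 (r ^ k) := by
  rw [mul_pow, mul_min]
  refine min_le_min ?_ le_rfl
  rw [mul_one]
  exact one_le_pow₀ (by norm_num)

theorem hasWeakDeriv_dyadicCorr {ψ : Rd d → ℝ} (hψ : IsTest ψ) (i : ℕ) {e : Rd d → 𝕜}
    (he : IsBdd e) (α : Fin d → ℕ) :
    HasWeakDeriv α (corr ψ (((2 : ℝ) ^ i)⁻¹) e)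
      (dyadicCorr (multiDeriv α ψ) (multiLength α) i e) :=
  hasWeakDeriv_corr hψ (inv_two_pow_ne_zero i) he α

/-- The derivative of the difference of two consecutive smooth approximations. -/
noncomputable def dyadicStep (ψ : Rd d → ℝ) (l j : ℕ) (e : Rd d → 𝕜) (x : Rd d) : 𝕜 :=
  dyadicCorr ψ l (j + 1) e x + dyadicCorr ψ l j e x

theorem enorm_dyadicStep_le {ψ : Rd d → ℝ} (hψ : IsTest ψ) (l j : ℕ) (e : Rd d → 𝕜) (x : Rd d) :
    ‖dyadicStep ψ l j e x‖ₑ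
      ≤ (2 ^ l + 1) * (∫⁻ y, ‖ψ y‖ₑ) * ((2 ^ j) ^ l * eLpNorm e ∞ volume) := by
  refine (enorm_add_le _ _).trans ((add_le_add (enorm_dyadicCorr_le hψ l (j + 1) e x)
    (enorm_dyadicCorr_le hψ l j e x)).trans_eq ?_)
  ring

theorem enorm_fwdDiff_dyadicStep_le {ψ : Rd d → ℝ} (hψ : IsTest ψ) {k : ℕ} {C : ℝ≥0∞}
    (hC : ∀ h, ∫⁻ x, ‖(fwdDiff h)^[k] ψ x‖ₑ ≤ C * min 1 (‖h‖ₑ ^ k)) (l j : ℕ) {e : Rd d → 𝕜}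
    (he : IsBdd e) (h x : Rd d) :
    ‖(fwdDiff h)^[k] (dyadicStep ψ l j e) x‖ₑ
      ≤ (2 ^ l * 2 ^ k + 1) * C *
        (min 1 ((2 ^ j * ‖h‖ₑ) ^ k) * ((2 ^ j) ^ l * eLpNorm e ∞ volume)) := by
  have h1 : dyadicStep ψ l j e = dyadicCorr ψ l (j + 1) e + dyadicCorr ψ l j e := rfl
  rw [h1, fwdDiff_iter_add]
  refine (enorm_add_le _ _).trans ((add_le_add
    (enorm_fwdDiff_dyadicCorr_le hψ hC l (j + 1) he h x)
    (enorm_fwdDiff_dyadicCorr_le hψ hC l j he h x)).trans ?_)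
  have h2 := min_two_mul_pow_le k (2 ^ j * ‖h‖ₑ)
  rw [← mul_assoc, ← pow_succ'] at h2
  calc _ ≤ (2 ^ (j + 1)) ^ l * (C * (2 ^ k * min 1 ((2 ^ j * ‖h‖ₑ) ^ k)) * eLpNorm e ∞ volume)
        + (2 ^ j) ^ l * (C * min 1 ((2 ^ j * ‖h‖ₑ) ^ k) * eLpNorm e ∞ volume) := by gcongr
    _ = _ := by ring

/-! ### Telescoping the squared approximations -/

/-- The squared approximation operator at scale `2^{-j}`. -/
noncomputable def smoothApprox (m j : ℕ) (f : Rd d → 𝕜) : Rd d → 𝕜 :=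
  corr (diffKernel d m) (((2 : ℝ) ^ j)⁻¹) (corr (diffKernel d m) (((2 : ℝ) ^ j)⁻¹) f)

/-- The difference of two consecutive approximations. -/
noncomputable def approxStep (m j : ℕ) (f : Rd d → 𝕜) (x : Rd d) : 𝕜 :=
  corr (diffKernel d m) (((2 : ℝ) ^ (j + 1))⁻¹) f x - corr (diffKernel d m) (((2 : ℝ) ^ j)⁻¹) f x

theorem IsBdd.approxStep {f : Rd d → 𝕜} (hf : IsBdd f) (m j : ℕ) : IsBdd (approxStep m j f) :=
  (hf.corr (isTest_diffKernel m) _).sub (hf.corr (isTest_diffKernel m) _)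

/-- A difference of squares, whose cross terms cancel by `corr_comm`. Each step thus keeps a smooth
kernel on the outside to absorb derivatives. -/
theorem smoothApprox_succ {f : Rd d → 𝕜} (hf : IsBdd f) (m j : ℕ) (x : Rd d) :
    smoothApprox m (j + 1) f x = smoothApprox m j f x
      + (corr (diffKernel d m) (((2 : ℝ) ^ (j + 1))⁻¹) (approxStep m j f) x
        + corr (diffKernel d m) (((2 : ℝ) ^ j)⁻¹) (approxStep m j f) x) := by
  have hK := isTest_diffKernel (d := d) m
  have h1 : ∀ i, corr (diffKernel d m) (((2 : ℝ) ^ i)⁻¹) (approxStep m j f) x = _ := fun i =>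
    corr_sub_right hK (((2 : ℝ) ^ i)⁻¹) (hf.corr hK (((2 : ℝ) ^ (j + 1))⁻¹))
      (hf.corr hK (((2 : ℝ) ^ j)⁻¹)) x
  rw [h1, h1, corr_comm hK hK (((2 : ℝ) ^ (j + 1))⁻¹) (((2 : ℝ) ^ j)⁻¹) hf]
  simp only [smoothApprox]
  ring

theorem eLpNorm_sub_rev (f g : Rd d → 𝕜) :
    eLpNorm (fun x => f x - g x) ∞ volume = eLpNorm (fun x => g x - f x) ∞ volume := by
  rw [← eLpNorm_neg]
  congr 1
  funext x
  simp

theorem eLpNorm_approxStep_le {C : ℝ≥0∞} (hC : ∀ y, ‖stdBump d y‖ₑ ≤ C) (hCt : C ≠ ∞)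
    {f : Rd d → 𝕜} (hf : IsBdd f) (m j : ℕ) :
    eLpNorm (approxStep m j f) ∞ volume ≤ C * (1 + 2 ^ d) *
      ballAvg (fun h => eLpNorm ((fwdDiff h)^[m] f) ∞ volume) (((2 : ℝ) ^ j)⁻¹) := by
  have hK := isTest_diffKernel (d := d) m
  set w : Rd d → ℝ≥0∞ := fun h => eLpNorm ((fwdDiff h)^[m] f) ∞ volume
  set t : ℝ := ((2 : ℝ) ^ j)⁻¹ with ht
  have ht0 : 0 < t := by positivity
  have e1 : ((2 : ℝ) ^ (j + 1))⁻¹ = t / 2 := by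
    rw [ht, pow_succ, mul_inv, div_eq_mul_inv]
  have h1 : approxStep m j f = (fun x => f x - corr (diffKernel d m) t f x)
      - (fun x => f x - corr (diffKernel d m) (t / 2) f x) := by
    funext x
    simp only [approxStep, e1, Pi.sub_apply]
    ring
  rw [h1]
  refine (eLpNorm_sub_le (hf.sub (hf.corr hK _)).meas.aestronglyMeasurable
    (hf.sub (hf.corr hK _)).meas.aestronglyMeasurable le_top).trans ?_
  calc _ ≤ C * ballAvg w t + C * ballAvg w (t / 2) :=
        add_le_add (eLpNorm_sub_corr_diffKernel_le hC hCt hf m ht0)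
          (eLpNorm_sub_corr_diffKernel_le hC hCt hf m (half_pos ht0))
    _ ≤ C * ballAvg w t + C * (2 ^ d * ballAvg w t) := by
        gcongr
        exact ballAvg_half_le w ht0
    _ = _ := by ring

theorem eLpNorm_smoothApprox_sub_le {C : ℝ≥0∞} (hC : ∀ y, ‖stdBump d y‖ₑ ≤ C) (hCt : C ≠ ∞)
    {f : Rd d → 𝕜} (hf : IsBdd f) (m j : ℕ) :
    eLpNorm (fun x => smoothApprox m j f x - f x) ∞ volume
      ≤ ((∫⁻ y, ‖diffKernel d m y‖ₑ) + 1) * C *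
      ballAvg (fun h => eLpNorm ((fwdDiff h)^[m] f) ∞ volume) (((2 : ℝ) ^ j)⁻¹) := by
  have hK := isTest_diffKernel (d := d) m
  set w : Rd d → ℝ≥0∞ := fun h => eLpNorm ((fwdDiff h)^[m] f) ∞ volume
  set t : ℝ := ((2 : ℝ) ^ j)⁻¹ with ht
  have ht0 : 0 < t := by positivity
  set e : Rd d → 𝕜 := fun x => corr (diffKernel d m) t f x - f x with he
  have he' : IsBdd e := (hf.corr hK t).sub hf
  have hle : eLpNorm e ∞ volume ≤ C * ballAvg w t := by
    rw [he, eLpNorm_sub_rev]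
    exact eLpNorm_sub_corr_diffKernel_le hC hCt hf m ht0
  -- T²f - f = T(Tf - f) + (Tf - f).
  have h1 : (fun x => smoothApprox m j f x - f x) = corr (diffKernel d m) t e + e := by
    funext x
    rw [Pi.add_apply, he, corr_sub_right hK t (hf.corr hK t) hf, smoothApprox]
    ring
  rw [h1]
  refine (eLpNorm_add_le (he'.corr hK t).meas.aestronglyMeasurable
    he'.meas.aestronglyMeasurable le_top).trans ?_
  calc _ ≤ (∫⁻ y, ‖diffKernel d m y‖ₑ) * eLpNorm e ∞ volume + eLpNorm e ∞ volume := by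
        gcongr
        exact eLpNorm_top_le (Filter.Eventually.of_forall fun x => enorm_corr_le ht0.ne' hK e x)
    _ ≤ (∫⁻ y, ‖diffKernel d m y‖ₑ) * (C * ballAvg w t) + C * ballAvg w t := by gcongr
    _ = _ := by ring

/-- Existence of a bounded weak derivative, together with pointwise bounds for it and for its
differences, when the dyadic averages of the differences of `f` are summable. -/
theorem exists_hasWeakDeriv_of_tsum_ballAvg (m k n : ℕ) (α : Fin d → ℕ) (hα : multiLength α ≤ n) :
    ∃ A : ℝ≥0∞, A ≠ ∞ ∧ ∀ (𝕜 : Type) [RCLike 𝕜] (f : Rd d → 𝕜) (a : ℕ → ℝ≥0∞), IsBdd f →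
      (∀ j, a j = (2 ^ j) ^ n *
        ballAvg (fun h => eLpNorm ((fwdDiff h)^[m] f) ∞ volume) (((2 : ℝ) ^ j)⁻¹)) →
      ∑' j, a j ≠ ∞ → ∃ g : Rd d → 𝕜, IsBdd g ∧ HasWeakDeriv α f g ∧
        (∀ x, ‖g x‖ₑ ≤ A * (eLpNorm f ∞ volume + ∑' j, a j)) ∧
        ∀ h x, ‖(fwdDiff h)^[k] g x‖ₑ ≤ A * (min 1 (‖h‖ₑ ^ k) * eLpNorm f ∞ volume
          + ∑' j, min 1 ((2 ^ j * ‖h‖ₑ) ^ k) * a j) := by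
  have hK := isTest_diffKernel (d := d) m
  obtain ⟨B, hBt, hB⟩ := exists_stdBump_bound d
  set ψ := multiDeriv α (diffKernel d m) with hψdef
  have hψ : IsTest ψ := hK.multiDeriv α
  obtain ⟨C, hCt, hC⟩ := exists_lintegral_fwdDiff_iterate_le hψ k
  set l := multiLength α with hl
  set κ : ℝ≥0∞ := ∫⁻ y, ‖diffKernel d m y‖ₑ with hκ
  set ι : ℝ≥0∞ := ∫⁻ y, ‖ψ y‖ₑ with hι
  have hκt : κ ≠ ∞ := hK.integrable.2.ne
  have hιt : ι ≠ ∞ := hψ.integrable.2.ne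
  set D : ℝ≥0∞ := B * (1 + 2 ^ d) with hD
  set A1 : ℝ≥0∞ := (2 ^ l + 1) * ι * D with hA1
  set A2 : ℝ≥0∞ := (2 ^ l * 2 ^ k + 1) * C * D with hA2
  set A3 : ℝ≥0∞ := (ι + C) * κ with hA3
  have h2t : ∀ i : ℕ, (2 : ℝ≥0∞) ^ i ≠ ∞ := two_pow_ne_top
  have hDt : D ≠ ∞ := ENNReal.mul_ne_top hBt (ENNReal.add_ne_top.2 ⟨by simp, h2t _⟩)
  have hA1t : A1 ≠ ∞ := ENNReal.mul_ne_top (ENNReal.mul_ne_top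
    (ENNReal.add_ne_top.2 ⟨h2t _, by simp⟩) hιt) hDt
  have hA2t : A2 ≠ ∞ := ENNReal.mul_ne_top (ENNReal.mul_ne_top
    (ENNReal.add_ne_top.2 ⟨ENNReal.mul_ne_top (h2t _) (h2t _), by simp⟩) hCt) hDt
  have hA3t : A3 ≠ ∞ := ENNReal.mul_ne_top (ENNReal.add_ne_top.2 ⟨hιt, hCt⟩) hκt
  refine ⟨A1 + A2 + A3, ENNReal.add_ne_top.2 ⟨ENNReal.add_ne_top.2 ⟨hA1t, hA2t⟩, hA3t⟩,
    fun 𝕜 _ f a hf ha hsum => ?_⟩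
  set M := eLpNorm f ∞ volume with hM
  set e : ℕ → Rd d → 𝕜 := fun j => approxStep m j f with he
  have heB : ∀ j, IsBdd (e j) := fun j => hf.approxStep m j
  -- Here |α| ≤ n is used: 2^{jl} ≤ 2^{jn}.
  have hea : ∀ j, (2 ^ j) ^ l * eLpNorm (e j) ∞ volume ≤ D * a j := by
    intro j
    rw [ha j]
    calc (2 ^ j) ^ l * eLpNorm (e j) ∞ volume ≤ (2 ^ j) ^ n * (D *
          ballAvg (fun h => eLpNorm ((fwdDiff h)^[m] f) ∞ volume) (((2 : ℝ) ^ j)⁻¹)) := by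
          gcongr
          · exact one_le_pow₀ (by norm_num)
          · exact eLpNorm_approxStep_le hB hBt hf m j
      _ = _ := by ring
  set G : ℕ → Rd d → 𝕜 := fun j => dyadicStep ψ l j (e j) with hG
  have hGB : ∀ j, IsBdd (G j) := fun j =>
    ((heB j).dyadicCorr hψ l (j + 1)).add ((heB j).dyadicCorr hψ l j)
  have hG1 : ∀ j x, ‖G j x‖ₑ ≤ A1 * a j := fun j x => by
    refine (enorm_dyadicStep_le hψ l j (e j) x).trans ?_
    rw [hA1, mul_assoc _ D]
    exact mul_le_mul_right (hea j) _
  have hG2 : ∀ j h x, ‖(fwdDiff h)^[k] (G j) x‖ₑ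
      ≤ A2 * (min 1 ((2 ^ j * ‖h‖ₑ) ^ k) * a j) := fun j h x => by
    refine (enorm_fwdDiff_dyadicStep_le hψ hC l j (heB j) h x).trans ?_
    rw [hA2, mul_assoc _ D, mul_left_comm D]
    exact mul_le_mul_right (mul_le_mul_right (hea j) _) _
  have hGs : ∑' j, A1 * a j ≠ ∞ := by
    rw [ENNReal.tsum_mul_left]
    exact ENNReal.mul_ne_top hA1t hsum
  -- The coarsest term is T_0² f = T_0 f1; its derivative v is controlled by ‖f‖_∞ alone.
  set f1 := corr (diffKernel d m) (((2 : ℝ) ^ 0)⁻¹) f with hf1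
  have hf1B : IsBdd f1 := hf.corr hK _
  have hf1M : eLpNorm f1 ∞ volume ≤ κ * M :=
    eLpNorm_top_le (Filter.Eventually.of_forall fun x =>
      enorm_corr_le (inv_two_pow_ne_zero 0) hK f x)
  set v := dyadicCorr ψ l 0 f1 with hv
  have hvB : IsBdd v := hf1B.dyadicCorr hψ l 0
  have hv1 : ∀ x, ‖v x‖ₑ ≤ ι * κ * M := fun x => by
    refine (enorm_dyadicCorr_le hψ l 0 f1 x).trans ?_
    rw [pow_zero, one_pow, one_mul, mul_assoc]
    exact mul_le_mul_right hf1M _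
  have hv2 : ∀ h x, ‖(fwdDiff h)^[k] v x‖ₑ ≤ C * κ * (min 1 (‖h‖ₑ ^ k) * M) := fun h x => by
    refine (enorm_fwdDiff_dyadicCorr_le hψ hC l 0 hf1B h x).trans ?_
    rw [pow_zero, one_pow, one_mul, one_mul]
    calc C * min 1 (‖h‖ₑ ^ k) * eLpNorm f1 ∞ volume ≤ C * min 1 (‖h‖ₑ ^ k) * (κ * M) := by gcongr
      _ = _ := by ring
  have hWv : ∀ J, HasWeakDeriv α (smoothApprox m J f)
      (fun x => v x + ∑ j ∈ Finset.range J, G j x) := by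
    intro J
    induction J with
    | zero =>
      simp only [Finset.range_zero, Finset.sum_empty, add_zero]
      exact hasWeakDeriv_dyadicCorr hK 0 hf1B α
    | succ J ih =>
      have h1 := ih.add ((hasWeakDeriv_dyadicCorr hK (J + 1) (heB J) α).add
        (hasWeakDeriv_dyadicCorr hK J (heB J) α))
      refine h1.congr (Filter.Eventually.of_forall fun x => ?_)
        (Filter.Eventually.of_forall fun x => ?_)
      · exact (smoothApprox_succ hf m J x).symm
      · simp only [Finset.sum_range_succ, ← add_assoc]
        simp only [hG, dyadicStep, ← add_assoc]
        rfl
  have hgB : IsBdd (fun x => v x + ∑' j, G j x) :=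
    hvB.add (isBdd_tsum (fun j => (hGB j).meas) hG1 hGs)
  refine ⟨fun x => v x + ∑' j, G j x, hgB, ?_, fun x => ?_, fun h x => ?_⟩
  · refine HasWeakDeriv.of_tendsto hWv hf.locallyIntegrable hgB.locallyIntegrable ?_
      (tendsto_eLpNorm_partialSum_sub hG1 hGs v)
    -- The local averages are at most a_j because 2^{jn} ≥ 1, and a_j → 0 by summability, so T_j² f
    -- converges to f in sup norm.
    have hlim : Filter.Tendsto (fun j => (κ + 1) * B * a j) Filter.atTop (nhds 0) := by
      have := ENNReal.Tendsto.const_mul (ENNReal.tendsto_atTop_zero_of_tsum_ne_top hsum)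
        (Or.inr (ENNReal.mul_ne_top (ENNReal.add_ne_top.2 ⟨hκt, by simp⟩) hBt))
        (a := (κ + 1) * B)
      rwa [mul_zero] at this
    refine tendsto_of_tendsto_of_tendsto_of_le_of_le tendsto_const_nhds hlim
      (fun _ => zero_le) fun j => ?_
    refine (eLpNorm_smoothApprox_sub_le hB hBt hf m j).trans (mul_le_mul_right ?_ _)
    rw [ha j]
    exact le_mul_of_one_le_left zero_le (one_le_pow₀ (one_le_pow₀ (by norm_num)))
  · refine (enorm_add_le _ _).trans ?_
    have h1 : ‖∑' j, G j x‖ₑ ≤ A1 * ∑' j, a j := by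
      rw [← ENNReal.tsum_mul_left]
      exact enorm_tsum_le_tsum_enorm.trans (ENNReal.tsum_le_tsum fun j => hG1 j x)
    calc ‖v x‖ₑ + ‖∑' j, G j x‖ₑ ≤ (A1 + A2 + A3) * M + (A1 + A2 + A3) * ∑' j, a j := by
          refine add_le_add ((hv1 x).trans ?_) (h1.trans ?_)
          · gcongr
            rw [hA3, add_mul ι]
            exact le_add_left le_self_add
          · gcongr
            rw [add_assoc]
            exact le_self_add
      _ = _ := by ring
  · have h0 := fwdDiff_iterate_tsum (fun x => summable_of_enorm_le (fun j => hG1 j x) hGs) h k x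
    have h1 : ‖∑' j, (fwdDiff h)^[k] (G j) x‖ₑ
        ≤ A2 * ∑' j, min 1 ((2 ^ j * ‖h‖ₑ) ^ k) * a j := by
      rw [← ENNReal.tsum_mul_left]
      exact enorm_tsum_le_tsum_enorm.trans (ENNReal.tsum_le_tsum fun j => hG2 j h x)
    have h2 : (fun x => v x + ∑' j, G j x) = v + fun x => ∑' j, G j x := rfl
    rw [h2, fwdDiff_iter_add, Pi.add_apply, h0.2]
    refine (enorm_add_le _ _).trans ?_
    calc _ ≤ (A1 + A2 + A3) * (min 1 (‖h‖ₑ ^ k) * M)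
          + (A1 + A2 + A3) * ∑' j, min 1 ((2 ^ j * ‖h‖ₑ) ^ k) * a j := by
          refine add_le_add ((hv2 h x).trans ?_) (h1.trans ?_)
          · gcongr
            rw [hA3, add_mul ι]
            exact le_add_left le_add_self
          · gcongr
            rw [add_assoc, add_left_comm]
            exact le_self_add
      _ = _ := by ring

end HolderZygmund

namespace HolderZygmund

/-! ### Bounded derivatives from the Hölder-Zygmund norm -/

variable {d : ℕ}

theorem tsum_two_pow_rpow_neg_ne_top {δ : ℝ} (hδ : 0 < δ) :
    ∑' j : ℕ, ((2 : ℝ≥0∞) ^ j) ^ (-δ) ≠ ∞ := by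
  have h : ∀ j : ℕ, ((2 : ℝ≥0∞) ^ j) ^ (-δ) = ((2 : ℝ≥0∞) ^ (-δ)) ^ j := fun j => by
    rw [← ENNReal.rpow_natCast, ← ENNReal.rpow_natCast, ← ENNReal.rpow_mul, ← ENNReal.rpow_mul,
      mul_comm]
  simp only [h]
  rw [ENNReal.tsum_geometric]
  have h1 : (2 : ℝ≥0∞) ^ (-δ) < 1 := ENNReal.rpow_lt_one_of_one_lt_of_neg (by norm_num) (by linarith)
  simpa [tsub_eq_zero_iff_le] using h1

theorem lt_diffOrder (δ : ℝ) : δ < diffOrder δ := by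
  simpa [diffOrder] using Nat.lt_floor_add_one δ

/-- Functions with finite Hölder-Zygmund norm have bounded weak derivatives, whose norms are
controlled. -/
theorem exists_weakDeriv_bound (hd : 1 ≤ d) {n : ℕ} {δ : ℝ} (hδ : 0 < δ) {p : ℝ≥0∞} (hp : 1 < p)
    (α : Fin d → ℕ) :
    ∃ C : ℝ≥0∞, C ≠ ∞ ∧ (multiLength α ≤ n → ∀ (𝕜 : Type) [RCLike 𝕜] (f : Rd d → 𝕜), IsBdd f →
      zygmundNorm (n + δ) p f ≠ ∞ → ∃ g : Rd d → 𝕜, IsBdd g ∧ HasWeakDeriv α f g ∧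
        eLpNorm g ∞ volume ≤ C * zygmundNorm (n + δ) p f ∧
        zygmundSeminorm δ p g ≤ C * zygmundNorm (n + δ) p f) := by
  by_cases hα : multiLength α ≤ n
  swap
  -- A dummy constant for |α| > n, so that constants can later be chosen for all multi-indices at
  -- once.
  · exact ⟨0, ENNReal.zero_ne_top, fun h => absurd h hα⟩
  have hγ : 0 < (n : ℝ) + δ := by positivity
  set k := diffOrder δ with hk
  have hδk : δ < k := lt_diffOrder δ
  obtain ⟨A, hA, hdec⟩ := exists_hasWeakDeriv_of_tsum_ballAvg (diffOrder (n + δ)) k n α hα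
  obtain ⟨C1, hC1, hseq⟩ := exists_seqNorm_dyadicAvg_le hd hγ hp
  obtain ⟨C2, hC2, hmaj⟩ := exists_zygmundSeminorm_le_seqNorm hd hδ hδk hp
  set E := ∑' j : ℕ, ((2 : ℝ≥0∞) ^ j) ^ (-δ) with hE
  have hEt : E ≠ ∞ := tsum_two_pow_rpow_neg_ne_top hδ
  set X1 := A * (1 + C1 * E) with hX1
  set X2 := C2 * (A * (2 * (C1 + 1))) with hX2
  have hX1t : X1 ≠ ∞ :=
    ENNReal.mul_ne_top hA (ENNReal.add_ne_top.2 ⟨by simp, ENNReal.mul_ne_top hC1 hEt⟩)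
  have hX2t : X2 ≠ ∞ := ENNReal.mul_ne_top hC2 (ENNReal.mul_ne_top hA
    (ENNReal.mul_ne_top (by simp) (ENNReal.add_ne_top.2 ⟨hC1, by simp⟩)))
  refine ⟨X1 + X2, ENNReal.add_ne_top.2 ⟨hX1t, hX2t⟩, fun _ 𝕜 _ f hf hz => ?_⟩
  set M := eLpNorm f ∞ volume with hM
  set S := zygmundSeminorm (n + δ) p f with hS
  have hzMS : zygmundNorm (n + δ) p f = M + S := rfl
  rw [hzMS] at hz ⊢
  have hSt : S ≠ ∞ := (ENNReal.add_ne_top.1 hz).2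
  set b : ℕ → ℝ≥0∞ := dyadicAvg ((n : ℝ) + δ) (diffNorm (n + δ) f) with hb
  have hbS : seqNorm p b ≤ C1 * S := hseq 𝕜 f hf.meas.aestronglyMeasurable
  -- Since γ - δ = n, these are the averages scaled by 2^{jn}. Each b_j is at most the ℓ_p norm of
  -- b, so the factor 2^{-jδ} alone makes them summable.
  set a : ℕ → ℝ≥0∞ := fun j => ((2 : ℝ≥0∞) ^ j) ^ (-δ) * b j with ha
  have haj : ∀ j, a j = (2 ^ j) ^ n * ballAvg
      (fun h => eLpNorm ((fwdDiff h)^[diffOrder (n + δ)] f) ∞ volume) (((2 : ℝ) ^ j)⁻¹) := by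
    intro j
    simp only [ha, hb, dyadicAvg]
    rw [← mul_assoc, ← ENNReal.rpow_add _ _ (two_pow_ne_zero' j) (two_pow_ne_top j),
      neg_add_eq_sub, add_sub_cancel_right, ENNReal.rpow_natCast]
    rfl
  have hasum : ∑' j, a j ≤ C1 * E * S := by
    calc ∑' j, a j ≤ ∑' j : ℕ, ((2 : ℝ≥0∞) ^ j) ^ (-δ) * (C1 * S) :=
          ENNReal.tsum_le_tsum fun j => mul_le_mul_right ((le_seqNorm hp b j).trans hbS) _
      _ = C1 * E * S := by
          rw [ENNReal.tsum_mul_right]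
          ring
  obtain ⟨g, hgB, hgW, hg1, hg2⟩ := hdec 𝕜 f a hf haj
    (ne_top_of_le_ne_top (ENNReal.mul_ne_top (ENNReal.mul_ne_top hC1 hEt) hSt) hasum)
  refine ⟨g, hgB, hgW, ?_, ?_⟩
  · refine (eLpNorm_top_le (Filter.Eventually.of_forall hg1)).trans ?_
    calc A * (M + ∑' j, a j) ≤ A * (M + C1 * E * S) := by gcongr
      _ ≤ A * ((1 + C1 * E) * M + (1 + C1 * E) * S) := by
          gcongr
          · exact le_mul_of_one_le_left zero_le le_self_add
          · exact le_add_self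
      _ = X1 * (M + S) := by ring
      _ ≤ (X1 + X2) * (M + S) := by
          gcongr
          exact le_self_add
  -- The coarsest contribution min(1, |h|^k) ‖f‖_∞ has the form of the term j = 0 of the majorant.
  · have h1 : ∀ h, diffNorm δ g h
        ≤ A * dyadicMajorant k δ (fun j => b j + if j = 0 then M else 0) ‖h‖ₑ := by
      intro h
      refine (eLpNorm_top_le (Filter.Eventually.of_forall (hg2 h))).trans (mul_le_mul_right ?_ _)
      rw [dyadicMajorant]
      simp only [mul_add]
      rw [ENNReal.tsum_add, add_comm]
      refine add_le_add le_rfl ?_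
      refine le_trans (le_of_eq ?_) (ENNReal.le_tsum 0)
      simp [← hM, -eLpNorm_exponent_top]
    calc zygmundSeminorm δ p g
        ≤ C2 * (A * seqNorm p (fun j => b j + if j = 0 then M else 0)) := hmaj 𝕜 g A _ hA h1
      _ ≤ C2 * (A * (2 * (seqNorm p b + M))) := by
          gcongr
          exact seqNorm_add_single_le hp b M
      _ ≤ C2 * (A * (2 * ((C1 + 1) * S + (C1 + 1) * M))) := by
          gcongr
          · exact hbS.trans (mul_le_mul_left le_self_add _)
          · exact le_mul_of_one_le_left zero_le le_add_self
      _ = X2 * (M + S) := by ring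
      _ ≤ (X1 + X2) * (M + S) := by
          gcongr
          exact le_add_self

end HolderZygmund

namespace HolderZygmund

variable {d : ℕ} {𝕜 : Type*} [RCLike 𝕜]

/-! ### Differences controlled by weak derivatives -/

theorem HasWeakDeriv.fwdDiff {α : Fin d → ℕ} {f g : Rd d → 𝕜} (hfg : HasWeakDeriv α f g)
    (h : Rd d) : HasWeakDeriv α (fwdDiff h f) (fwdDiff h g) :=
  (hfg.comp_add_right h).sub hfg

theorem HasWeakDeriv.fwdDiff_iterate {α : Fin d → ℕ} {f g : Rd d → 𝕜} (hfg : HasWeakDeriv α f g)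
    (h : Rd d) (k : ℕ) : HasWeakDeriv α ((_root_.fwdDiff h)^[k] f) ((_root_.fwdDiff h)^[k] g) := by
  induction k with
  | zero => exact hfg
  | succ k ih =>
    rw [Function.iterate_succ_apply', Function.iterate_succ_apply']
    exact ih.fwdDiff h

/-- The test function is z ↦ ρ(x - z): the sign from the reflection cancels the one in the
definition of the weak derivative. -/
theorem integral_partialDeriv_smul_sub {ρ : Rd d → ℝ} (hρ : IsTest ρ) {i : Fin d}
    {f g : Rd d → 𝕜} (hfg : HasWeakDeriv (Pi.single i 1) f g) (x : Rd d) :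
    ∫ y, partialDeriv i ρ y • f (x - y) = ∫ z, ρ (x + (-1 : ℝ) • z) • g z := by
  have h1 := hρ.comp_affine (neg_ne_zero.2 one_ne_zero) x
  have h2 := hfg.2.2 _ h1.smooth h1.compact
  rw [multiDeriv_single h1, multiLength_single, pow_one] at h2
  have h3 : ∀ z, partialDeriv i (fun y => ρ (x + (-1 : ℝ) • y)) z • f z
      = (-1 : ℝ) • (partialDeriv i ρ (x - z) • f z) := fun z => by
    rw [partialDeriv_comp_affine hρ, mul_smul, neg_one_smul ℝ z, ← sub_eq_add_neg]
  simp only [h3] at h2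
  rw [integral_smul] at h2
  have h4 := smul_right_injective 𝕜 (neg_ne_zero.2 (one_ne_zero (α := ℝ))) h2
  rw [← h4, ← integral_sub_left_eq_self (fun z => partialDeriv i ρ (x - z) • f z) volume x]
  simp

/-- The partial derivatives of ρ * f are ρ * g_i, bounded by G_i because ρ is a probability density;
then the mean value inequality applies. The constant does not depend on ρ, so ρ may shrink. -/
theorem norm_convolution_sub_le {ρ : Rd d → ℝ} (hρ : IsTest ρ) (hρ0 : ∀ x, 0 ≤ ρ x)
    (hρ1 : ∫ x, ρ x = 1) {f : Rd d → 𝕜} {g : Fin d → Rd d → 𝕜}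
    (hfg : ∀ i, HasWeakDeriv (Pi.single i 1) f (g i)) {G : Fin d → ℝ}
    (hG : ∀ i, ∀ᵐ x, ‖g i x‖ ≤ G i) (hf : LocallyIntegrable f) (x h : Rd d) :
    ‖convolution ρ f (ContinuousLinearMap.lsmul ℝ ℝ) volume (x + h)
      - convolution ρ f (ContinuousLinearMap.lsmul ℝ ℝ) volume x‖ ≤ (∑ i, G i) * ‖h‖ := by
  have hG0 : ∀ i, 0 ≤ G i := fun i => by
    obtain ⟨y, hy⟩ := (hG i).exists
    exact (norm_nonneg _).trans hy
  have hder := fun y => HasCompactSupport.hasFDerivAt_convolution_left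
    (ContinuousLinearMap.lsmul ℝ ℝ) hρ.compact (hρ.smooth.of_le (by simp)) hf y
  have hbound : ∀ y v, ‖convolution (fderiv ℝ ρ) f
      (ContinuousLinearMap.precompL (Rd d) (ContinuousLinearMap.lsmul ℝ ℝ)) volume y v‖
      ≤ (∑ i, G i) * ‖v‖ := by
    intro y v
    have hint : Integrable (fun t => ContinuousLinearMap.precompL (Rd d)
        (ContinuousLinearMap.lsmul ℝ ℝ : ℝ →L[ℝ] 𝕜 →L[ℝ] 𝕜) (fderiv ℝ ρ t) (f (y - t))) :=
      (hρ.compact.fderiv (𝕜 := ℝ)).convolutionExists_left _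
        (hρ.smooth.continuous_fderiv (by simp)) hf y
    have e1 : convolution (fderiv ℝ ρ) f
        (ContinuousLinearMap.precompL (Rd d) (ContinuousLinearMap.lsmul ℝ ℝ)) volume y v
        = ∫ t, fderiv ℝ ρ t v • f (y - t) := by
      rw [convolution, ContinuousLinearMap.integral_apply hint]
      rfl
    have hv : ∀ t, fderiv ℝ ρ t v = ∑ i, v i * partialDeriv i ρ t := fun t => by
      conv_lhs => rw [← (EuclideanSpace.basisFun (Fin d) ℝ).sum_repr v]
      simp [partialDeriv]
    have hfi : ∀ i, Integrable (fun t => partialDeriv i ρ t • f (y - t)) := fun i =>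
      (hρ.partialDeriv i).compact.convolutionExists_left (ContinuousLinearMap.lsmul ℝ ℝ)
        (hρ.partialDeriv i).continuous hf y
    have e2 : ∫ t, fderiv ℝ ρ t v • f (y - t)
        = ∑ i, v i • ∫ z, ρ (y + (-1 : ℝ) • z) • g i z := by
      simp only [hv, Finset.sum_smul, mul_smul]
      rw [integral_finsetSum _ fun i _ => (hfi i).fun_smul _]
      refine Finset.sum_congr rfl fun i _ => ?_
      rw [integral_smul, integral_partialDeriv_smul_sub hρ (hfg i)]
    have hρy : IsTest (fun z => ρ (y + (-1 : ℝ) • z)) :=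
      hρ.comp_affine (neg_ne_zero.2 one_ne_zero) y
    have e3 : ∀ i, ‖∫ z, ρ (y + (-1 : ℝ) • z) • g i z‖ ≤ G i := by
      intro i
      have h1 : ∫ z, ρ (y + (-1 : ℝ) • z) * G i = G i := by
        rw [integral_mul_const]
        have : ∫ z, ρ (y + (-1 : ℝ) • z) = ∫ z, ρ z := by
          simp only [neg_one_smul, ← sub_eq_add_neg]
          exact integral_sub_left_eq_self ρ volume y
        rw [this, hρ1, one_mul]
      refine (norm_integral_le_of_norm_le (hρy.integrable.mul_const (G i)) ?_).trans_eq h1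
      filter_upwards [hG i] with z hz
      rw [norm_smul, Real.norm_of_nonneg (hρ0 _)]
      exact mul_le_mul_of_nonneg_left hz (hρ0 _)
    rw [e1, e2, Finset.sum_mul]
    refine (norm_sum_le _ _).trans (Finset.sum_le_sum fun i _ => ?_)
    rw [norm_smul, mul_comm]
    exact mul_le_mul (e3 i) (PiLp.norm_apply_le v i) (norm_nonneg _) (hG0 i)
  have := Convex.norm_image_sub_le_of_norm_hasFDerivWithin_le (s := Set.univ)
    (fun y _ => (hder y).hasFDerivWithinAt)
    (fun y _ => ContinuousLinearMap.opNorm_le_bound _ (Finset.sum_nonneg fun i _ => hG0 i)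
      (hbound y)) convex_univ (Set.mem_univ x) (Set.mem_univ (x + h))
  simpa using this

/-- A shrinking sequence of bump functions. -/
noncomputable def shrinkingBump (d n : ℕ) : ContDiffBump (0 : Rd d) where
  rIn := 1 / ((n : ℝ) + 1) / 2
  rOut := 1 / ((n : ℝ) + 1)
  rIn_pos := by positivity
  rIn_lt_rOut := half_lt_self (by positivity)

theorem ae_tendsto_shrinkingBump {f : Rd d → 𝕜} (hf : LocallyIntegrable f) :
    ∀ᵐ x, Filter.Tendsto (fun n => convolution ((shrinkingBump d n).normed volume) f
      (ContinuousLinearMap.lsmul ℝ ℝ) volume x) Filter.atTop (nhds (f x)) := by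
  refine ContDiffBump.ae_convolution_tendsto_right_of_locallyIntegrable (K := 2) ?_ ?_ hf
  · exact tendsto_one_div_add_atTop_nhds_zero_nat
  · refine Filter.Eventually.of_forall fun n => le_of_eq ?_
    simp only [shrinkingBump]
    ring

/-- For almost every x the mollifications converge at both x and x + h, and the uniform Lipschitz
bound passes to the limit. The case h = 0 is separate because the right side is then 0 even for an
unbounded gradient. -/
theorem eLpNorm_fwdDiff_le {f : Rd d → 𝕜} {g : Fin d → Rd d → 𝕜}
    (hfg : ∀ i, HasWeakDeriv (Pi.single i 1) f (g i)) (hf : LocallyIntegrable f) (h : Rd d) :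
    eLpNorm (fwdDiff h f) ∞ volume ≤ ‖h‖ₑ * ∑ i, eLpNorm (g i) ∞ volume := by
  by_cases h0 : h = 0
  · subst h0
    have : fwdDiff (0 : Rd d) f = 0 := by
      funext x
      simp [fwdDiff]
    rw [this, eLpNorm_zero]
    exact zero_le
  by_cases htop : ∑ i, eLpNorm (g i) ∞ volume = ∞
  · rw [htop, ENNReal.mul_top (by simpa using h0)]
    exact le_top
  have hfin : ∀ i, eLpNorm (g i) ∞ volume ≠ ∞ := fun i =>
    ENNReal.sum_ne_top.1 htop i (Finset.mem_univ i)
  set G : Fin d → ℝ := fun i => (eLpNorm (g i) ∞ volume).toReal with hGdef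
  have hG : ∀ i, ∀ᵐ x, ‖g i x‖ ≤ G i := fun i => by
    filter_upwards [ae_le_eLpNorm_top (g i)] with x hx
    rw [← ofReal_norm] at hx
    exact (ENNReal.ofReal_le_iff_le_toReal (hfin i)).1 hx
  have hGsum : ENNReal.ofReal (∑ i, G i) = ∑ i, eLpNorm (g i) ∞ volume := by
    rw [ENNReal.ofReal_sum_of_nonneg fun i _ => ENNReal.toReal_nonneg]
    exact Finset.sum_congr rfl fun i _ => ENNReal.ofReal_toReal (hfin i)
  have h1 := ae_tendsto_shrinkingBump hf
  have h2 := (measurePreserving_add_right (volume : Measure (Rd d)) h).quasiMeasurePreserving.ae h1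
  refine eLpNorm_top_le ?_
  filter_upwards [h1, h2] with x hx hxh
  have h3 : ‖f (x + h) - f x‖ ≤ (∑ i, G i) * ‖h‖ := by
    refine le_of_tendsto ((hxh.sub hx).norm) (Filter.Eventually.of_forall fun n => ?_)
    exact norm_convolution_sub_le
      ⟨ContDiffBump.contDiff_normed _, ContDiffBump.hasCompactSupport_normed _⟩
      (fun x => ContDiffBump.nonneg_normed _ x) (ContDiffBump.integral_normed _) hfg hG hf x h
  rw [← hGsum, mul_comm, ← ofReal_norm h, ← ENNReal.ofReal_mul
    (Finset.sum_nonneg fun i _ => ENNReal.toReal_nonneg), ← ofReal_norm]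
  exact ENNReal.ofReal_le_ofReal h3

/-! ### Trading differences for derivatives -/

theorem mem_piAntidiag_iff (α : Fin d → ℕ) (l : ℕ) :
    α ∈ Finset.piAntidiag (Finset.univ : Finset (Fin d)) l ↔ multiLength α = l := by
  simp [multiLength]

/-- Weak derivatives commute with differences, so the Lipschitz bound can be applied j times. Each
application sums over d directions, and each direction is bounded crudely by the whole final sum,
whence the factor d. -/
theorem eLpNorm_fwdDiff_iterate_add_le {n : ℕ} {f : Rd d → 𝕜} {D : (Fin d → ℕ) → Rd d → 𝕜}
    (hD : ∀ α, multiLength α ≤ n → HasWeakDeriv α f (D α)) (k j : ℕ) (α : Fin d → ℕ)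
    (hα : multiLength α + j ≤ n) (h : Rd d) :
    eLpNorm ((fwdDiff h)^[k + j] (D α)) ∞ volume ≤ (d * ‖h‖ₑ) ^ j *
      ∑ β ∈ Finset.piAntidiag (Finset.univ : Finset (Fin d)) (multiLength α + j),
        eLpNorm ((fwdDiff h)^[k] (D β)) ∞ volume := by
  induction j generalizing α with
  | zero =>
    rw [pow_zero, one_mul, add_zero, add_zero]
    exact Finset.single_le_sum
      (f := fun β => eLpNorm ((fwdDiff h)^[k] (D β)) ∞ volume) (fun _ _ => zero_le)
      ((mem_piAntidiag_iff α _).2 rfl)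
  | succ j ih =>
    have hW : ∀ i, HasWeakDeriv (Pi.single i 1) ((fwdDiff h)^[k + j] (D α))
        ((fwdDiff h)^[k + j] (D (α + Pi.single i 1))) := fun i =>
      (HasWeakDeriv.of_add (hD α (by omega))
        (hD (α + Pi.single i 1) (by rw [multiLength_add_single]; omega))).fwdDiff_iterate h _
    have hli : LocallyIntegrable ((fwdDiff h)^[k + j] (D α)) :=
      ((hD α (by omega)).fwdDiff_iterate h (k + j)).2.1
    rw [← add_assoc, Function.iterate_succ_apply']
    refine (eLpNorm_fwdDiff_le hW hli h).trans ?_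
    set V := ∑ β ∈ Finset.piAntidiag (Finset.univ : Finset (Fin d)) (multiLength α + (j + 1)),
        eLpNorm ((fwdDiff h)^[k] (D β)) ∞ volume
    have hi : ∀ i, eLpNorm ((fwdDiff h)^[k + j] (D (α + Pi.single i 1))) ∞ volume
        ≤ (d * ‖h‖ₑ) ^ j * V := fun i => by
      have := ih (α + Pi.single i 1) (by rw [multiLength_add_single]; omega)
      rwa [multiLength_add_single, add_assoc, add_comm 1 j] at this
    calc ‖h‖ₑ * ∑ i, eLpNorm ((fwdDiff h)^[k + j] (D (α + Pi.single i 1))) ∞ volume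
        ≤ ‖h‖ₑ * ∑ _i : Fin d, (d * ‖h‖ₑ) ^ j * V := by
          gcongr with i
          exact hi i
      _ = (d * ‖h‖ₑ) ^ (j + 1) * V := by
          rw [Finset.sum_const, Finset.card_univ, Fintype.card_fin, nsmul_eq_mul]
          ring

theorem diffOrder_natCast_add (n : ℕ) {δ : ℝ} (hδ : 0 ≤ δ) :
    diffOrder ((n : ℝ) + δ) = diffOrder δ + n := by
  rw [diffOrder, diffOrder, add_comm (n : ℝ), Nat.floor_add_natCast hδ]
  ring

theorem diffNorm_le_sum_diffNorm {n : ℕ} {δ : ℝ} (hδ : 0 ≤ δ) {f : Rd d → 𝕜}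
    {D : (Fin d → ℕ) → Rd d → 𝕜}
    (hD : ∀ α, multiLength α ≤ n → HasWeakDeriv α f (D α)) (h : Rd d) :
    diffNorm (n + δ) f h ≤ (d * ‖h‖ₑ) ^ n *
      ∑ β ∈ Finset.piAntidiag (Finset.univ : Finset (Fin d)) n, diffNorm δ (D β) h := by
  have h0 := hD 0 (by simp)
  have hf0 : f =ᵐ[volume] D 0 := (hasWeakDeriv_zero h0.1).unique h0
  rw [diffNorm_congr hf0]
  have := eLpNorm_fwdDiff_iterate_add_le hD (diffOrder δ) n 0 (by simp) h
  rw [multiLength_zero, zero_add] at this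
  rw [diffNorm, diffOrder_natCast_add n hδ]
  exact this

theorem sum_rpow_le {ι : Type*} (s : Finset ι) (v : ι → ℝ≥0∞) {q : ℝ} (hq : 0 < q) :
    (∑ i ∈ s, v i) ^ q ≤ (s.card : ℝ≥0∞) ^ q * ∑ i ∈ s, v i ^ q := by
  rcases s.eq_empty_or_nonempty with rfl | hs
  · simp [hq]
  · obtain ⟨i0, hi0, hmax⟩ := s.exists_max_image v hs
    have h1 : ∑ i ∈ s, v i ≤ s.card * v i0 := by
      rw [← nsmul_eq_mul]
      exact Finset.sum_le_card_nsmul s v _ hmax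
    refine (ENNReal.rpow_le_rpow h1 hq.le).trans ?_
    rw [ENNReal.mul_rpow_of_nonneg _ _ hq.le]
    gcongr
    exact Finset.single_le_sum (f := fun i => v i ^ q) (fun _ _ => zero_le) hi0

theorem sum_le_card_rpow_mul {ι : Type*} (s : Finset ι) (X : ι → ℝ≥0∞) {q : ℝ} (hq : 0 < q) :
    (∑ i ∈ s, X i) ^ (1 / q) ≤ (s.card : ℝ≥0∞) ^ (1 / q) * ∑ i ∈ s, X i ^ (1 / q) :=
  sum_rpow_le s X (by positivity)

/-- The factor |h|^n gained from n derivatives turns the weight of order γ into that of order δ. The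
remaining finite sum over β comes out of the power and of the root at the price of powers of its
cardinality. -/
theorem zygmundSeminorm_le_sum (hd : 1 ≤ d) {n : ℕ} {δ : ℝ} (hδ : 0 < δ) {p : ℝ≥0∞} (hp : 1 < p) :
    ∃ C : ℝ≥0∞, C ≠ ∞ ∧ ∀ (𝕜 : Type) [RCLike 𝕜] (f : Rd d → 𝕜) (D : (Fin d → ℕ) → Rd d → 𝕜),
      (∀ α, multiLength α ≤ n → HasWeakDeriv α f (D α)) →
      zygmundSeminorm (n + δ) p f ≤ C *
        ∑ β ∈ Finset.piAntidiag (Finset.univ : Finset (Fin d)) n, zygmundSeminorm δ p (D β) := by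
  have : Nonempty (Fin d) := ⟨⟨0, hd⟩⟩
  set s := Finset.piAntidiag (Finset.univ : Finset (Fin d)) n with hs
  have hdn : (d : ℝ≥0∞) ^ n ≠ ∞ := by simp
  by_cases h : p = ∞
  · subst h
    refine ⟨(d : ℝ≥0∞) ^ n, hdn, fun 𝕜 _ f D hD => ?_⟩
    simp only [zygmundSeminorm, if_true]
    refine iSup_le fun h => ?_
    by_cases h0 : h = 0
    · subst h0
      rw [diffNorm_zero, ENNReal.zero_div]
      exact zero_le
    have hr0 : ‖h‖ₑ ≠ 0 := by simpa using h0
    have hrt : ‖h‖ₑ ≠ ∞ := enorm_ne_top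
    calc diffNorm (n + δ) f h / ‖h‖ₑ ^ ((n : ℝ) + δ)
        ≤ ((d * ‖h‖ₑ) ^ n * ∑ β ∈ s, diffNorm δ (D β) h) / ‖h‖ₑ ^ ((n : ℝ) + δ) :=
          ENNReal.div_le_div_right (diffNorm_le_sum_diffNorm hδ.le hD h) _
      _ = (d : ℝ≥0∞) ^ n * ∑ β ∈ s, diffNorm δ (D β) h / ‖h‖ₑ ^ δ := by
          rw [mul_pow, ENNReal.rpow_add _ _ hr0 hrt, ENNReal.rpow_natCast, mul_assoc, mul_div_assoc,
            ENNReal.mul_div_mul_left _ _ (by simp [h0]) (by finiteness)]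
          simp only [div_eq_mul_inv, Finset.sum_mul]
      _ ≤ _ := by
          gcongr with β
          exact le_iSup (fun h : Rd d => diffNorm δ (D β) h / ‖h‖ₑ ^ δ) h
  · have h1 := one_lt_toReal hp h
    set q := p.toReal with hq
    have h0 : 0 < q := one_pos.trans h1
    have hq0 : 0 ≤ 1 / q := by positivity
    set c1 : ℝ≥0∞ := ((d : ℝ≥0∞) ^ n) ^ q * (s.card : ℝ≥0∞) ^ q with hc1
    have hc1t : c1 ≠ ∞ := ENNReal.mul_ne_top (ENNReal.rpow_ne_top_of_nonneg h0.le hdn)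
      (ENNReal.rpow_ne_top_of_nonneg h0.le (by simp))
    refine ⟨c1 ^ (1 / q) * (s.card : ℝ≥0∞) ^ (1 / q), ENNReal.mul_ne_top
      (ENNReal.rpow_ne_top_of_nonneg hq0 hc1t) (ENNReal.rpow_ne_top_of_nonneg hq0 (by simp)),
      fun 𝕜 _ f D hD => ?_⟩
    simp only [zygmundSeminorm, if_neg h]
    rw [← hq]
    have hmeas : ∀ β ∈ s, Measurable (diffNorm δ (D β)) := fun β hβ =>
      measurable_diffNorm (hD β ((mem_piAntidiag_iff β n).1 hβ).le).2.1.aestronglyMeasurable δ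
    have hpt : ∀ h : Rd d, h ≠ 0 → diffNorm (n + δ) f h ^ q / ‖h‖ₑ ^ ((d : ℝ) + q * (n + δ))
        ≤ c1 * ∑ β ∈ s, diffNorm δ (D β) h ^ q / ‖h‖ₑ ^ ((d : ℝ) + q * δ) := by
      intro h hh
      have hr0 : ‖h‖ₑ ≠ 0 := by simpa using hh
      have hrt : ‖h‖ₑ ≠ ∞ := enorm_ne_top
      have e1 : ‖h‖ₑ ^ ((d : ℝ) + q * (n + δ))
          = (‖h‖ₑ ^ n) ^ q * ‖h‖ₑ ^ ((d : ℝ) + q * δ) := by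
        rw [← ENNReal.rpow_natCast, ← ENNReal.rpow_mul, ← ENNReal.rpow_add _ _ hr0 hrt]
        congr 1
        ring
      have hn0 : (‖h‖ₑ ^ n) ^ q ≠ 0 := by
        rw [← ENNReal.rpow_natCast, ← ENNReal.rpow_mul]
        exact (ENNReal.rpow_pos (pos_iff_ne_zero.2 hr0) hrt).ne'
      have hnt : (‖h‖ₑ ^ n) ^ q ≠ ∞ := ENNReal.rpow_ne_top_of_nonneg h0.le (by finiteness)
      have h2 : diffNorm (n + δ) f h ^ q
          ≤ (‖h‖ₑ ^ n) ^ q * (c1 * ∑ β ∈ s, diffNorm δ (D β) h ^ q) := by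
        refine (ENNReal.rpow_le_rpow (diffNorm_le_sum_diffNorm hδ.le hD h) h0.le).trans ?_
        rw [mul_pow, ENNReal.mul_rpow_of_nonneg _ _ h0.le, ENNReal.mul_rpow_of_nonneg _ _ h0.le]
        calc _ ≤ ((d : ℝ≥0∞) ^ n) ^ q * (‖h‖ₑ ^ n) ^ q *
              ((s.card : ℝ≥0∞) ^ q * ∑ β ∈ s, diffNorm δ (D β) h ^ q) :=
              mul_le_mul_right (sum_rpow_le s _ h0) _
          _ = _ := by ring
      refine (ENNReal.div_le_div_right h2 _).trans (le_of_eq ?_)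
      rw [e1, ENNReal.mul_div_mul_left _ _ hn0 hnt, mul_div_assoc]
      simp only [div_eq_mul_inv, Finset.sum_mul]
    have hI : ∫⁻ h : Rd d, diffNorm (n + δ) f h ^ q / ‖h‖ₑ ^ ((d : ℝ) + q * (n + δ))
        ≤ c1 * ∑ β ∈ s, ∫⁻ h : Rd d, diffNorm δ (D β) h ^ q / ‖h‖ₑ ^ ((d : ℝ) + q * δ) := by
      rw [← lintegral_finsetSum' _ fun β hβ => by
        have := hmeas β hβ
        fun_prop, ← lintegral_const_mul' _ _ hc1t]
      refine lintegral_mono_ae ?_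
      filter_upwards [Measure.ae_ne volume (0 : Rd d)] with h hh using hpt h hh
    refine (ENNReal.rpow_le_rpow hI hq0).trans ?_
    rw [ENNReal.mul_rpow_of_nonneg _ _ hq0, mul_assoc]
    exact mul_le_mul_right (sum_le_card_rpow_mul s _ h0) _

end HolderZygmund

namespace HolderZygmund

/-! ### The two norm inequalities and their combination -/

variable {d : ℕ}

theorem exists_derivNorm_le (hd : 1 ≤ d) {n : ℕ} {δ : ℝ} (hδ : 0 < δ) {p : ℝ≥0∞} (hp : 1 < p) :
    ∃ C : ℝ≥0∞, C ≠ ∞ ∧ ∀ (𝕜 : Type) [RCLike 𝕜] (f : Rd d → 𝕜), MemLp f ∞ volume →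
      zygmundNorm (n + δ) p f ≠ ∞ → ∃ g : (Fin d → ℕ) → Rd d → 𝕜,
        (∀ α, multiLength α ≤ n → HasWeakDeriv α f (g α) ∧ MemLp (g α) ∞ volume) ∧
        derivNorm n δ p g ≤ C * zygmundNorm (n + δ) p f := by
  choose C hCt hC using exists_weakDeriv_bound (d := d) hd (n := n) hδ hp
  refine ⟨(∑ l ∈ Finset.range (n + 1), ∑ α ∈ Finset.piAntidiag (Finset.univ : Finset (Fin d)) l,
    C α) + ∑ β ∈ Finset.piAntidiag (Finset.univ : Finset (Fin d)) n, C β, ?_,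
    fun 𝕜 _ f hf hz => ?_⟩
  · exact ENNReal.add_ne_top.2 ⟨ENNReal.sum_ne_top.2 fun l _ => ENNReal.sum_ne_top.2 fun α _ => hCt α,
      ENNReal.sum_ne_top.2 fun α _ => hCt α⟩
  · obtain ⟨u, huB, hfu⟩ := exists_isBdd_ae_eq hf
    have hzu := zygmundNorm_congr hfu (n + δ) p
    rw [hzu] at hz ⊢
    have hex : ∀ α, ∃ g : Rd d → 𝕜, multiLength α ≤ n → IsBdd g ∧ HasWeakDeriv α u g ∧
        eLpNorm g ∞ volume ≤ C α * zygmundNorm (n + δ) p u ∧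
        zygmundSeminorm δ p g ≤ C α * zygmundNorm (n + δ) p u := fun α => by
      by_cases hα : multiLength α ≤ n
      · obtain ⟨g, hg⟩ := hC α hα 𝕜 u huB hz
        exact ⟨g, fun _ => hg⟩
      · exact ⟨0, fun h => absurd h hα⟩
    choose g hg using hex
    refine ⟨g, fun α hα => ⟨(hg α hα).2.1.congr hfu.symm (ae_eq_refl _), (hg α hα).1.memLp⟩, ?_⟩
    rw [derivNorm, add_mul, Finset.sum_mul, Finset.sum_mul]
    refine add_le_add (Finset.sum_le_sum fun l hl => ?_) (Finset.sum_le_sum fun β hβ => ?_)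
    · rw [Finset.sum_mul]
      refine Finset.sum_le_sum fun α hα => (hg α ?_).2.2.1
      have := (mem_piAntidiag_iff α l).1 hα
      have := Finset.mem_range.1 hl
      omega
    · exact (hg β ((mem_piAntidiag_iff β n).1 hβ).le).2.2.2

/-- Combined with uniqueness of weak derivatives, this carries the bound for the constructed
derivatives over to any given ones. -/
theorem derivNorm_congr {𝕜 : Type*} [RCLike 𝕜] {n : ℕ} (δ : ℝ) (p : ℝ≥0∞)
    {D D' : (Fin d → ℕ) → Rd d → 𝕜}
    (h : ∀ α, multiLength α ≤ n → D α =ᵐ[volume] D' α) :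
    derivNorm n δ p D = derivNorm n δ p D' := by
  rw [derivNorm, derivNorm]
  congr 1
  · refine Finset.sum_congr rfl fun l hl => Finset.sum_congr rfl fun α hα => ?_
    refine eLpNorm_congr_ae (h α ?_)
    have := (mem_piAntidiag_iff α l).1 hα
    have := Finset.mem_range.1 hl
    omega
  · exact Finset.sum_congr rfl fun β hβ =>
      zygmundSeminorm_congr (h β ((mem_piAntidiag_iff β n).1 hβ).le) δ p

theorem exists_zygmundNorm_le (hd : 1 ≤ d) {n : ℕ} {δ : ℝ} (hδ : 0 < δ) {p : ℝ≥0∞} (hp : 1 < p) :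
    ∃ C : ℝ≥0∞, C ≠ ∞ ∧ ∀ (𝕜 : Type) [RCLike 𝕜] (f : Rd d → 𝕜) (D : (Fin d → ℕ) → Rd d → 𝕜),
      (∀ α, multiLength α ≤ n → HasWeakDeriv α f (D α)) →
      zygmundNorm (n + δ) p f ≤ C * derivNorm n δ p D := by
  obtain ⟨C, hC, hle⟩ := zygmundSeminorm_le_sum (d := d) hd (n := n) hδ hp
  -- The summand 1 pays for ‖f‖_∞, which is the term α = 0 of the derivative norm.
  refine ⟨C + 1, ENNReal.add_ne_top.2 ⟨hC, by simp⟩, fun 𝕜 _ f D hD => ?_⟩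
  have h0 := hD 0 (by simp)
  have hf0 : f =ᵐ[volume] D 0 := (hasWeakDeriv_zero h0.1).unique h0
  rw [zygmundNorm, derivNorm, mul_add]
  refine add_le_add ?_ ((hle 𝕜 f D hD).trans (mul_le_mul_left le_self_add _))
  rw [eLpNorm_congr_ae hf0]
  refine le_trans ?_ (le_mul_of_one_le_left zero_le le_add_self)
  refine le_trans ?_ (Finset.single_le_sum
    (f := fun l => ∑ α ∈ Finset.piAntidiag (Finset.univ : Finset (Fin d)) l,
      eLpNorm (D α) ∞ volume) (fun _ _ => zero_le) (Finset.mem_range.2 (Nat.succ_pos n)))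
  exact Finset.single_le_sum (f := fun α => eLpNorm (D α) ∞ volume) (fun _ _ => zero_le)
    ((mem_piAntidiag_iff 0 0).2 multiLength_zero)

end HolderZygmund

theorem proposition2p1 (d : ℕ) (hd : 1 ≤ d) (γ : ℝ) (n : ℕ) (δ : ℝ) (hδ : 0 < δ) (hδ1 : δ ≤ 1)
    (hγ : γ = (n : ℝ) + δ) (p : ENNReal) (hp : 1 < p) :
    ∃ N : NNReal, 0 < N ∧
      ∀ (𝕜 : Type) [RCLike 𝕜] (f : HolderZygmund.Rd d → 𝕜),
        MeasureTheory.MemLp f ⊤ MeasureTheory.volume →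
        -- finiteness of the norm forces the weak derivatives of order at most `n` to exist and be bounded
        (HolderZygmund.zygmundNorm γ p f < ⊤ →
          ∃ Df : (Fin d → ℕ) → HolderZygmund.Rd d → 𝕜,
            ∀ α : Fin d → ℕ, HolderZygmund.multiLength α ≤ n →
              HolderZygmund.HasWeakDeriv α f (Df α) ∧
                MeasureTheory.MemLp (Df α) ⊤ MeasureTheory.volume) ∧
        -- whenever these weak derivatives exist, the two norms are comparable in `[0, ∞]`
        (∀ Df : (Fin d → ℕ) → HolderZygmund.Rd d → 𝕜,
          (∀ α : Fin d → ℕ, HolderZygmund.multiLength α ≤ n →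
            HolderZygmund.HasWeakDeriv α f (Df α)) →
          HolderZygmund.zygmundNorm γ p f ≤ (N : ENNReal) * HolderZygmund.derivNorm n δ p Df ∧
          HolderZygmund.derivNorm n δ p Df ≤ (N : ENNReal) * HolderZygmund.zygmundNorm γ p f) := by
  subst hγ
  obtain ⟨C1, hC1, h1⟩ := HolderZygmund.exists_zygmundNorm_le hd (n := n) hδ hp
  obtain ⟨C2, hC2, h2⟩ := HolderZygmund.exists_derivNorm_le hd (n := n) hδ hp
  have hN : ((C1.toNNReal + C2.toNNReal + 1 : NNReal) : ENNReal) = C1 + C2 + 1 := by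
    push_cast
    rw [ENNReal.coe_toNNReal hC1, ENNReal.coe_toNNReal hC2]
  refine ⟨C1.toNNReal + C2.toNNReal + 1, by positivity, fun 𝕜 _ f hf => ⟨fun hz => ?_,
    fun Df hDf => ⟨?_, ?_⟩⟩⟩
  · obtain ⟨g, hg, -⟩ := h2 𝕜 f hf hz.ne
    exact ⟨g, hg⟩
  · refine (h1 𝕜 f Df hDf).trans ?_
    rw [hN, add_assoc]
    gcongr
    exact le_self_add
  · rw [hN]
    -- If the norm is infinite, the right side is ∞ because the constant is nonzero; otherwise the
    -- constructed derivatives agree almost everywhere with the given ones.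
    by_cases hz : HolderZygmund.zygmundNorm ((n : ℝ) + δ) p f = ⊤
    · rw [hz, ENNReal.mul_top (by simp)]
      exact le_top
    · obtain ⟨g, hg, hle⟩ := h2 𝕜 f hf hz
      rw [HolderZygmund.derivNorm_congr δ p fun α hα => (hDf α hα).unique (hg α hα).1]
      refine hle.trans ?_
      gcongr
      rw [add_assoc, add_left_comm]
      exact le_self_add
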